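/- For $n\ge 1$ consider pairs $(\mu,\lambda)$, where $\mu$ is a partition of $n$ and $\lambda$ is a part of $\mu$ (the distinguished part), such that, after one copy of $\lambda$ is removed from $\mu$, every remaining part is either odd and $<2\lambda$, or equal to $2\lambda$ (parts may be repeated). Let $p_2(n)$ be the number of such pairs, each weighted by $(-1)^{k}$, where $k$ is the number of remaining parts, counted with multiplicity. Equivalently, $$\sum_{n\ge1}p_2(n)q^n=\sum_{m\ge1}\frac{q^m}{(1+q^{2m})(1+q)(1+q^3)\cdots(1+q^{2m-1})}.$$ Then both power series below converge for $|z|<1$, and as $z\to1^-$ through real values, $$\sum_{n\ge1}p_2(n)z^n=O\left(\frac1{1-z}\right),\qquad \sum_{\substack{n\ge1\\ p_2(n)>0}}z^n=O\left(\frac{1}{(1-z)\sqrt{\log\frac1{1-z}}}\right).$$ -/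

import Mathlib

open Filter Topology Asymptotics

/-- The pair `(μ, l)`: a partition `μ` of `n` with a distinguished part `l`. One copy of `l` is
guaranteed to appear in `μ`; each of the remaining parts (the parts of `μ` after removal of that
one copy of `l`) is either odd and `< 2 * l`, or equal to `2 * l`. Parts may be repeated. -/
def IsMarkedPartition {n : ℕ} (μ : n.Partition) (l : ℕ) : Prop :=
  l ∈ μ.parts ∧ ∀ k ∈ μ.parts.erase l, (Odd k ∧ k < 2 * l) ∨ k = 2 * l

instance {n : ℕ} (μ : n.Partition) (l : ℕ) : Decidable (IsMarkedPartition μ l) :=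
  inferInstanceAs (Decidable (_ ∧ _))

/-- The partitions of `n` with an admissible distinguished part, as pairs
`(partition, distinguished part)`. -/
def markedPartitions (n : ℕ) : Finset (n.Partition × ℕ) :=
  (Finset.univ ×ˢ Finset.range (n + 1)).filter fun x => IsMarkedPartition x.1 x.2

/-- Every part of a partition of `n` is `≤ n`, so the bound used in `markedPartitions` only serves
finiteness. -/
theorem mem_markedPartitions {n : ℕ} (x : n.Partition × ℕ) :
    x ∈ markedPartitions n ↔ IsMarkedPartition x.1 x.2 := by
  simp only [markedPartitions, Finset.mem_filter, Finset.mem_product, Finset.mem_univ,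
    Finset.mem_range, true_and, and_iff_right_iff_imp]
  intro h
  have := Multiset.single_le_sum (fun _ _ => Nat.zero_le _) _ h.1
  rw [x.1.parts_sum] at this
  omega

/-- The unsigned number of partitions of `n` with an admissible distinguished part. -/
def p₂' (n : ℕ) : ℕ := (markedPartitions n).card

/-- The count `p₂'`, each marked partition being weighted by `-1` to the number of parts other
than the (one copy of the) distinguished part. -/
def p₂ (n : ℕ) : ℤ :=
  ∑ x ∈ markedPartitions n, (-1) ^ (x.1.parts.erase x.2).card

/-! The generating series is a sum over a cone, ∑_{r ≥ 1} ∑_{1 ≤ k ≤ r} (-1)^⌊k/2⌋ q^(r² + 2⌊k/2⌋²);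
this is `p₂_eq_sum`. Both estimates then concern the positive definite form x² + 2y². At most √N ·
√N pairs (r, k) take a value ≤ N, so ∑_{n ≤ N} |p₂ n| ≤ N, and Abel summation gives the first bound.
If p₂ n ≠ 0 then n is represented by the form, and Landau's bound O(N / √log N) for such n
(`representedCount_bound`) gives the second.

The identity is a Bailey-pair argument. Put Q = q² and let c(m, r) be the coefficients of the finite
Jacobi triple product. For the odd sequence σ of partial theta sums, ∑_r c(m, r) σ(r) = (1 - Q^m)/(1
+ Q^m) · ∏_{i ≤ m} (1 + Q^i) (`tripleSum_of_increment`), so multiplying by the weight h_m =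
`pairWeight q m` gives exactly the m-th summand of the series. Exchanging the sums leaves ∑_m h_m
(c(m, r) - c(m, -r)) = q^(r²), which follows from a first-order recurrence in r whose defect
telescopes in m. All sums are truncated at M, with errors divisible by q^(M+1), so no convergence is
needed.

For Landau's bound, a represented n is c·g²·m with c ∈ {1, 2} and all primes of m congruent to 1 or
3 mod 8. With b the indicator of such m, comparing b * b with 1 * χ₈' gives ∑_{m ≤ N} b(m)/m ≪ √log
N; writing log = 1 * Λ and using Chebyshev's bound then gives ∑_{m ≤ N} b(m) log m ≪ N √log N. -/

/-! ### Finite Jacobi triple product and theta sequences -/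

section TripleProduct

variable {K : Type*} [Field K]

/-- The linear functional `w ↦ ∑ r, w r * c r`, where `∑ r, c r * x ^ r` is the finite Jacobi
triple product `∏_{i < m} (1 + x * Q ^ i) * (1 + x⁻¹ * Q ^ (i + 1))`. -/
def tripleSum (Q : K) : ℕ → (ℤ → K) → K
  | 0, w => w 0
  | m + 1, w => tripleSum Q m fun r =>
      (1 + Q ^ (2 * m + 1)) * w r + Q ^ m * w (r + 1) + Q ^ (m + 1) * w (r - 1)

theorem tripleSum_succ (Q : K) (m : ℕ) (w : ℤ → K) :
    tripleSum Q (m + 1) w = tripleSum Q m fun r =>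
      (1 + Q ^ (2 * m + 1)) * w r + Q ^ m * w (r + 1) + Q ^ (m + 1) * w (r - 1) := rfl

theorem tripleSum_add (Q : K) (m : ℕ) (v w : ℤ → K) :
    tripleSum Q m (fun r => v r + w r) = tripleSum Q m v + tripleSum Q m w := by
  induction m generalizing v w with
  | zero => rfl
  | succ m ih =>
    simp only [tripleSum_succ]
    rw [← ih]
    congr 1
    funext r
    ring

theorem tripleSum_const_mul (Q : K) (m : ℕ) (c : K) (w : ℤ → K) :
    tripleSum Q m (fun r => c * w r) = c * tripleSum Q m w := by
  induction m generalizing w with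
  | zero => rfl
  | succ m ih =>
    simp only [tripleSum_succ]
    rw [← ih]
    congr 1
    funext r
    ring

theorem tripleSum_succ' (Q : K) (m : ℕ) (w : ℤ → K) :
    tripleSum Q (m + 1) w = (1 + Q ^ (2 * m + 1)) * tripleSum Q m w
      + Q ^ m * tripleSum Q m (fun r => w (r + 1))
      + Q ^ (m + 1) * tripleSum Q m (fun r => w (r - 1)) := by
  rw [tripleSum_succ, tripleSum_add, tripleSum_add, tripleSum_const_mul, tripleSum_const_mul,
    tripleSum_const_mul]

theorem tripleSum_congr (Q : K) (m : ℕ) {v w : ℤ → K}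
    (h : ∀ r : ℤ, |r| ≤ m → v r = w r) : tripleSum Q m v = tripleSum Q m w := by
  induction m generalizing v w with
  | zero => exact h 0 (by simp)
  | succ m ih =>
    rw [tripleSum_succ, tripleSum_succ]
    refine ih fun r hr => ?_
    rw [abs_le] at hr
    rw [h r (by rw [abs_le]; push_cast; omega), h (r + 1) (by rw [abs_le]; push_cast; omega),
      h (r - 1) (by rw [abs_le]; push_cast; omega)]

theorem tripleSum_sum (Q : K) (m : ℕ) {ι : Type*} (s : Finset ι) (w : ι → ℤ → K) :
    tripleSum Q m (fun r => ∑ i ∈ s, w i r) = ∑ i ∈ s, tripleSum Q m (w i) := by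
  classical
  induction s using Finset.induction_on with
  | empty =>
    have := tripleSum_const_mul Q m 0 (fun _ => 0)
    simpa using this
  | insert a s ha ih =>
    simp only [Finset.sum_insert ha, tripleSum_add, ih]

/-- The product is invariant under x ↦ Q / x. -/
theorem tripleSum_reflect {Q : K} (hQ : Q ≠ 0) (m : ℕ) (w : ℤ → K) :
    tripleSum Q m (fun r => Q ^ r * w (-r)) = tripleSum Q m w := by
  induction m generalizing w with
  | zero => simp [tripleSum]
  | succ m ih =>
    simp only [tripleSum_succ]
    refine Eq.trans ?_ (ih _)
    congr 1
    funext r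
    have h1 : -(r + 1) = -r - 1 := by ring
    have h2 : -(r - 1) = -r + 1 := by ring
    rw [h1, h2, zpow_add₀ hQ, zpow_sub₀ hQ]
    field_simp
    ring

/-- Replacing x by Q x shifts the factors of the product P, and cancelling gives (x + Q^m) P(Q x) =
(1 + Q^m x) P(x). -/
theorem tripleSum_functional {Q : K} (hQ : Q ≠ 0) (m : ℕ) (w : ℤ → K) :
    tripleSum Q m (fun r => Q ^ r * (w (r + 1) + Q ^ m * w r))
      = tripleSum Q m (fun r => w r + Q ^ m * w (r + 1)) := by
  induction m generalizing w with
  | zero => simp [tripleSum, add_comm]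
  | succ m ih =>
    simp only [tripleSum_succ]
    have := ih fun r => (1 + Q ^ (2 * m + 2)) * w r + Q ^ (m + 1) * w (r + 1)
      + Q ^ (m + 1) * w (r - 1)
    convert this using 2
    · funext r
      rw [zpow_add₀ hQ, zpow_sub₀ hQ]
      have h1 : r + 1 - 1 = r := by ring
      have h2 : r - 1 + 1 = r := by ring
      rw [h1, h2]
      field_simp
      ring
    · funext r
      have h1 : r + 1 - 1 = r := by ring
      have h2 : r - 1 + 1 = r := by ring
      rw [h1, h2]
      ring

/-- The sequence supported on even integers with value `(-1) ^ s * Q ^ (s ^ 2)` at `2 * s`. -/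
def evenTheta (Q : K) (r : ℤ) : K :=
  if Even r then (-1) ^ (r / 2).natAbs * Q ^ ((r / 2).natAbs ^ 2) else 0

theorem evenTheta_two_mul (Q : K) (s : ℤ) :
    evenTheta Q (2 * s) = (-1) ^ s.natAbs * Q ^ (s.natAbs ^ 2) := by
  simp [evenTheta]

theorem evenTheta_two_mul_add_one (Q : K) (s : ℤ) : evenTheta Q (2 * s + 1) = 0 := by
  simp [evenTheta]

theorem evenTheta_neg (Q : K) (r : ℤ) : evenTheta Q (-r) = evenTheta Q r := by
  obtain ⟨s, rfl | rfl⟩ := r.even_or_odd'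
  · rw [← mul_neg, evenTheta_two_mul, evenTheta_two_mul, Int.natAbs_neg]
  · rw [show -(2 * s + 1) = 2 * (-s - 1) + 1 by ring, evenTheta_two_mul_add_one,
      evenTheta_two_mul_add_one]

theorem evenTheta_shift {Q : K} (hQ : Q ≠ 0) (r : ℤ) :
    Q ^ r * evenTheta Q (r - 1) = -evenTheta Q (r + 1) := by
  obtain ⟨s, rfl | rfl⟩ := r.even_or_odd'
  · rw [show 2 * s - 1 = 2 * (s - 1) + 1 by ring, evenTheta_two_mul_add_one,
      evenTheta_two_mul_add_one]
    simp
  · rw [show 2 * s + 1 - 1 = 2 * s by ring, show 2 * s + 1 + 1 = 2 * (s + 1) by ring,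
      evenTheta_two_mul, evenTheta_two_mul]
    have h1 : (-1 : K) ^ (s + 1).natAbs = - (-1) ^ s.natAbs := by
      rcases Int.even_or_odd s with h | h
      · have h' : Odd (s + 1) := h.add_one
        rw [(Int.natAbs_even.2 h).neg_one_pow, (Int.natAbs_odd.2 h').neg_one_pow]
      · have h' : Even (s + 1) := h.add_one
        rw [(Int.natAbs_odd.2 h).neg_one_pow, (Int.natAbs_even.2 h').neg_one_pow, neg_neg]
    have h2 : ∀ t : ℤ, Q ^ (t.natAbs ^ 2) = Q ^ (t ^ 2) := by
      intro t
      rw [← zpow_natCast, Nat.cast_pow, Int.natCast_natAbs, sq_abs]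
    rw [h1, h2, h2, show (s + 1) ^ 2 = (2 * s + 1) + s ^ 2 by ring, zpow_add₀ hQ (2 * s + 1)]
    ring

variable [CharZero K]

/-- By the reflection symmetry and `evenTheta_shift` this sum equals its own negative. -/
theorem tripleSum_evenTheta_add_one {Q : K} (hQ : Q ≠ 0) (m : ℕ) :
    tripleSum Q m (fun r => evenTheta Q (r + 1)) = 0 := by
  have h := tripleSum_reflect hQ m (fun r => evenTheta Q (r + 1))
  have h2 : (fun r : ℤ => Q ^ r * evenTheta Q (-r + 1)) =
      fun r => (-1) * evenTheta Q (r + 1) := by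
    funext r
    rw [show -r + 1 = -(r - 1) by ring, evenTheta_neg, evenTheta_shift hQ]
    ring
  rw [h2, tripleSum_const_mul] at h
  have h3 : 2 * tripleSum Q m (fun r => evenTheta Q (r + 1)) = 0 := by linear_combination -h
  simpa using h3

theorem tripleSum_evenTheta_sub_one {Q : K} (hQ : Q ≠ 0) (m : ℕ) :
    tripleSum Q m (fun r => evenTheta Q (r - 1)) = (1 - Q ^ m) * tripleSum Q m (evenTheta Q) := by
  have h := tripleSum_functional hQ m (fun r => evenTheta Q (r - 1))
  have h1 : (fun r : ℤ => Q ^ r * (evenTheta Q (r + 1 - 1) + Q ^ m * evenTheta Q (r - 1)))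
      = fun r => Q ^ r * evenTheta Q (-r) + (-Q ^ m) * evenTheta Q (r + 1) := by
    funext r
    rw [evenTheta_neg, add_sub_cancel_right]
    linear_combination Q ^ m * evenTheta_shift hQ r
  rw [h1, tripleSum_add, tripleSum_reflect hQ, tripleSum_const_mul,
    tripleSum_evenTheta_add_one hQ, tripleSum_add, tripleSum_const_mul] at h
  simp only [add_sub_cancel_right] at h
  linear_combination -h

theorem tripleSum_evenTheta {Q : K} (hQ : Q ≠ 0) (m : ℕ) :
    tripleSum Q m (evenTheta Q) = ∏ i ∈ Finset.range m, (1 + Q ^ (i + 1)) := by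
  induction m with
  | zero => simp [tripleSum, evenTheta]
  | succ m ih =>
    rw [tripleSum_succ', tripleSum_evenTheta_add_one hQ, tripleSum_evenTheta_sub_one hQ, ih,
      Finset.prod_range_succ]
    ring

/-- If `σ 0 = 0` and `σ` has increments given by `evenTheta`, its triple product sum is a
product. -/
theorem tripleSum_of_increment {Q : K} (hQ : Q ≠ 0) {σ : ℤ → K} (h0 : σ 0 = 0)
    (hσ : ∀ r, σ (r + 1) = σ r + evenTheta Q (r + 1) + evenTheta Q r) (m : ℕ) :
    (1 + Q ^ m) * tripleSum Q m σ = (1 - Q ^ m) * ∏ i ∈ Finset.range m, (1 + Q ^ (i + 1)) := by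
  -- Shifting σ by ±1 only adds `evenTheta` terms, whose sums are known, so the recursion closes on
  -- `tripleSum Q m σ`.
  have key : ∀ m, tripleSum Q (m + 1) σ = (1 + Q ^ m) * (1 + Q ^ (m + 1)) * tripleSum Q m σ
      + (Q ^ m - 2 * Q ^ (m + 1) + Q ^ (2 * m + 1))
        * ∏ i ∈ Finset.range m, (1 + Q ^ (i + 1)) := by
    intro m
    have h1 : (fun r => σ (r + 1)) = fun r => σ r + (evenTheta Q (r + 1) + evenTheta Q r) := by
      funext r
      rw [hσ, add_assoc]
    have h2 : (fun r => σ (r - 1)) = fun r =>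
        σ r + (-1) * (evenTheta Q r + evenTheta Q (r - 1)) := by
      funext r
      have := hσ (r - 1)
      rw [sub_add_cancel] at this
      rw [this]
      ring
    rw [tripleSum_succ', h1, h2, tripleSum_add, tripleSum_add, tripleSum_add, tripleSum_const_mul,
      tripleSum_add, tripleSum_evenTheta_add_one hQ, tripleSum_evenTheta_sub_one hQ,
      tripleSum_evenTheta hQ]
    ring
  induction m with
  | zero => simp [tripleSum, h0]
  | succ m ih =>
    rw [key, Finset.prod_range_succ]
    linear_combination (1 + Q ^ (m + 1)) ^ 2 * ih

end TripleProduct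

/-! ### Coefficients of the finite triple product -/

section TripleCoeff

variable {K : Type*} [Field K]

/-- The coefficient of `x ^ r` in the finite Jacobi triple product. -/
def tripleCoeff (Q : K) (m : ℕ) (r : ℤ) : K := tripleSum Q m (Pi.single r 1)

theorem tripleCoeff_neg {Q : K} (hQ : Q ≠ 0) (m : ℕ) (r : ℤ) :
    tripleCoeff Q m (-r) = Q ^ r * tripleCoeff Q m r := by
  have h := tripleSum_reflect hQ m (Pi.single r 1)
  have h2 : (fun x : ℤ => Q ^ x * (Pi.single r 1 : ℤ → K) (-x)) =
      fun x => Q ^ (-r) * (Pi.single (-r) 1 : ℤ → K) x := by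
    funext x
    by_cases hx : x = -r
    · subst hx; simp
    · have : -x ≠ r := fun h => hx (by omega)
      simp [Pi.single_eq_of_ne, hx, this]
  rw [h2, tripleSum_const_mul] at h
  rw [tripleCoeff, tripleCoeff, ← h, ← mul_assoc, ← zpow_add₀ hQ]
  simp

/-- Coefficient form of the functional equation; it avoids closed q-binomial formulas. -/
theorem tripleCoeff_add_one {Q : K} (hQ : Q ≠ 0) (m : ℕ) (r : ℤ) :
    tripleCoeff Q m (r + 1) * (1 - Q ^ m * Q ^ r * Q) = tripleCoeff Q m r * (Q ^ r - Q ^ m) := by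
  have h := tripleSum_functional hQ m (Pi.single (r + 1) 1)
  have h1 : (fun x : ℤ => Q ^ x * ((Pi.single (r + 1) 1 : ℤ → K) (x + 1)
      + Q ^ m * (Pi.single (r + 1) 1 : ℤ → K) x)) =
      fun x => Q ^ r * (Pi.single r 1 : ℤ → K) x
        + (Q ^ m * Q ^ r * Q) * (Pi.single (r + 1) 1 : ℤ → K) x := by
    funext x
    by_cases hx : x = r
    · subst hx; simp
    · by_cases hx' : x = r + 1
      · subst hx'; simp [zpow_add_one₀ hQ]; ring
      · simp [Pi.single_eq_of_ne, hx, hx']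
  have h2 : (fun x : ℤ => (Pi.single (r + 1) 1 : ℤ → K) x
      + Q ^ m * (Pi.single (r + 1) 1 : ℤ → K) (x + 1)) =
      fun x => (Pi.single (r + 1) 1 : ℤ → K) x + Q ^ m * (Pi.single r 1 : ℤ → K) x := by
    funext x
    by_cases hx : x = r
    · subst hx; simp
    · simp [Pi.single_eq_of_ne, hx]
  rw [h1, h2, tripleSum_add, tripleSum_add, tripleSum_const_mul, tripleSum_const_mul,
    tripleSum_const_mul] at h
  simp only [tripleCoeff]
  linear_combination -h

theorem tripleCoeff_succ (Q : K) (m : ℕ) (r : ℤ) :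
    tripleCoeff Q (m + 1) r = (1 + Q ^ (2 * m + 1)) * tripleCoeff Q m r
      + Q ^ m * tripleCoeff Q m (r - 1) + Q ^ (m + 1) * tripleCoeff Q m (r + 1) := by
  have h1 : (fun x : ℤ => (Pi.single r 1 : ℤ → K) (x + 1)) = Pi.single (r - 1) 1 := by
    funext x
    by_cases hx : x = r - 1
    · subst hx; simp
    · have : x + 1 ≠ r := fun h => hx (by omega)
      simp [Pi.single_eq_of_ne, hx, this]
  have h2 : (fun x : ℤ => (Pi.single r 1 : ℤ → K) (x - 1)) = Pi.single (r + 1) 1 := by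
    funext x
    by_cases hx : x = r + 1
    · subst hx; simp
    · have : x - 1 ≠ r := fun h => hx (by omega)
      simp [Pi.single_eq_of_ne, hx, this]
  rw [tripleCoeff, tripleSum_succ', h1, h2]
  rfl

theorem tripleCoeff_succ_mul {Q : K} (hQ : Q ≠ 0) (m : ℕ) (r : ℤ) :
    (Q ^ r - Q ^ (m + 1)) * tripleCoeff Q (m + 1) r = (1 - Q ^ (2 * m + 2)) * Q ^ r
      * (tripleCoeff Q m r + Q ^ (m + 1) * tripleCoeff Q m (r + 1)) := by
  rw [tripleCoeff_succ]
  have h1 := tripleCoeff_add_one hQ m r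
  have h2 := tripleCoeff_add_one hQ m (r - 1)
  have h3 : Q ^ (r - 1) * Q = Q ^ r := by rw [← zpow_add_one₀ hQ, sub_add_cancel]
  rw [sub_add_cancel] at h2
  have h4 : tripleCoeff Q m r * (1 - Q ^ m * Q ^ r) * Q
      = tripleCoeff Q m (r - 1) * (Q ^ r - Q ^ (m + 1)) := by
    rw [← h3]
    linear_combination Q * h2
  linear_combination (-Q ^ m) * h4 - Q ^ (2 * m + 2) * h1

theorem tripleCoeff_eq_zero (Q : K) {m : ℕ} {r : ℤ} (h : (m : ℤ) < |r|) :
    tripleCoeff Q m r = 0 := by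
  have h1 : tripleSum Q m (Pi.single r 1) = tripleSum Q m (fun x => 0 * 0) := by
    refine tripleSum_congr Q m fun x hx => ?_
    have : x ≠ r := by rintro rfl; omega
    simp [Pi.single_eq_of_ne, this]
  rw [tripleCoeff, h1, tripleSum_const_mul Q m 0 (fun _ => 0), zero_mul]

theorem tripleSum_mem {O : Subring K} {Q : K} (hQ : Q ∈ O) (m : ℕ) {w : ℤ → K}
    (hw : ∀ r, w r ∈ O) : tripleSum Q m w ∈ O := by
  induction m generalizing w with
  | zero => exact hw 0
  | succ m ih =>
    rw [tripleSum_succ]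
    refine ih fun r => ?_
    exact O.add_mem (O.add_mem (O.mul_mem (O.add_mem O.one_mem (O.pow_mem hQ _)) (hw _))
      (O.mul_mem (O.pow_mem hQ _) (hw _))) (O.mul_mem (O.pow_mem hQ _) (hw _))

theorem tripleCoeff_mem {O : Subring K} {Q : K} (hQ : Q ∈ O) (m : ℕ) (r : ℤ) :
    tripleCoeff Q m r ∈ O := by
  refine tripleSum_mem hQ m fun x => ?_
  by_cases hx : x = r
  · subst hx; simp [O.one_mem]
  · simp [Pi.single_eq_of_ne, hx, O.zero_mem]

/-- Coefficients with |r| > m vanish, so any M ≥ m may bound the sum; a bound independent of m is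
what permits exchanging sums later. -/
theorem tripleSum_odd (Q : K) {m M : ℕ} (hmM : m ≤ M) {w : ℤ → K} (hw : ∀ r, w (-r) = -w r)
    (h0 : w 0 = 0) :
    tripleSum Q m w = ∑ r ∈ Finset.Icc 1 M, w r * (tripleCoeff Q m r - tripleCoeff Q m (-r)) := by
  have h : tripleSum Q m w = tripleSum Q m (fun x => ∑ r ∈ Finset.Icc 1 M,
      (w r * (Pi.single (r : ℤ) 1 : ℤ → K) x
        + (-w r) * (Pi.single (-(r : ℤ)) 1 : ℤ → K) x)) := by
    refine tripleSum_congr Q m fun x hx => ?_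
    rw [abs_le] at hx
    obtain ⟨n, rfl | rfl⟩ := x.eq_nat_or_neg
    · rcases Nat.eq_zero_or_pos n with rfl | hn
      · rw [Finset.sum_eq_zero]
        · simpa using h0
        · intro r hr
          have := (Finset.mem_Icc.1 hr).1
          have h1 : (0 : ℤ) ≠ r := by omega
          have h2 : (0 : ℤ) ≠ -r := by omega
          simp [Pi.single_eq_of_ne, h1, h2]
      · rw [Finset.sum_eq_single n]
        · have h2 : (n : ℤ) ≠ -n := by omega
          simp [Pi.single_eq_of_ne, h2]
        · intro r hr hrn
          have := (Finset.mem_Icc.1 hr).1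
          have h1 : (n : ℤ) ≠ r := by omega
          have h2 : (n : ℤ) ≠ -r := by omega
          simp [Pi.single_eq_of_ne, h1, h2]
        · intro h
          exact absurd (Finset.mem_Icc.2 ⟨hn, by omega⟩) h
    · rcases Nat.eq_zero_or_pos n with rfl | hn
      · rw [Finset.sum_eq_zero]
        · simpa using h0
        · intro r hr
          have := (Finset.mem_Icc.1 hr).1
          have h1 : (0 : ℤ) ≠ r := by omega
          have h2 : (0 : ℤ) ≠ -r := by omega
          simp [Pi.single_eq_of_ne, h1, h2]
      · rw [Finset.sum_eq_single n]
        · have h2 : -(n : ℤ) ≠ n := by omega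
          simp [Pi.single_eq_of_ne, h2, hw]
        · intro r hr hrn
          have := (Finset.mem_Icc.1 hr).1
          have h1 : -(n : ℤ) ≠ r := by omega
          have h2 : -(n : ℤ) ≠ -r := by omega
          simp only [Pi.single_eq_of_ne h1, Pi.single_eq_of_ne h2]
          simp
        · intro h
          exact absurd (Finset.mem_Icc.2 ⟨hn, by omega⟩) h
  rw [h, tripleSum_sum]
  refine Finset.sum_congr rfl fun r _ => ?_
  rw [tripleSum_add, tripleSum_const_mul, tripleSum_const_mul]
  simp only [tripleCoeff]
  ring

end TripleCoeff

/-! ### Conjugate Bailey pair by telescoping -/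

section Telescoping

variable {K : Type*} [Field K]

/-- The weight `q ^ m / ((1 - q ^ (2 * m)) * ∏_{i ≤ 2 * m} (1 + q ^ i))`. -/
def pairWeight (q : K) (m : ℕ) : K :=
  q ^ m / ((1 - (q ^ 2) ^ m) * ∏ i ∈ Finset.range (2 * m), (1 + q ^ (i + 1)))

theorem pairWeight_succ {q : K} (hp : ∀ i, 1 + q ^ (i + 1) ≠ 0) (hm : ∀ i, 1 - q ^ (i + 1) ≠ 0)
    {m : ℕ} (h1 : 1 ≤ m) :
    pairWeight q (m + 1) * (1 - (q ^ 2) ^ (2 * m + 2)) * (1 + q * (q ^ 2) ^ m)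
      = q * (1 - (q ^ 2) ^ m) * pairWeight q m := by
  have e1 : (1 - (q ^ 2) ^ m) ≠ 0 := by
    have := hm (2 * m - 1)
    rwa [show 2 * m - 1 + 1 = 2 * m by omega, pow_mul] at this
  have e2 : (1 - (q ^ 2) ^ (m + 1)) ≠ 0 := by
    have := hm (2 * m + 1)
    rwa [show 2 * m + 1 + 1 = 2 * (m + 1) by omega, pow_mul] at this
  have e3 : ∏ i ∈ Finset.range (2 * m), (1 + q ^ (i + 1)) ≠ 0 :=
    Finset.prod_ne_zero_iff.2 fun i _ => hp i
  have e4 := hp (2 * m)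
  have e5 := hp (2 * m + 1)
  rw [pairWeight, pairWeight, show 2 * (m + 1) = 2 * m + 1 + 1 by ring, Finset.prod_range_succ,
    Finset.prod_range_succ]
  generalize ∏ i ∈ Finset.range (2 * m), (1 + q ^ (i + 1)) = P at *
  field_simp
  ring

/-- The telescoping companion of `pairWeight`. -/
def pairCertificate (q : K) (m r : ℕ) : K :=
  -(1 + q ^ (2 * r + 1)) * ((q ^ 2) ^ r - (q ^ 2) ^ m) * pairWeight q m * tripleCoeff (q ^ 2) m r

/-- A creative-telescoping certificate: the defect of the recurrence D(r+1) = q^(2r+1) D(r), solved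
by q^(r²), is a difference in m. -/
theorem pairWeight_telescope {q : K} (hq : q ≠ 0) (hp : ∀ i, 1 + q ^ (i + 1) ≠ 0)
    (hm : ∀ i, 1 - q ^ (i + 1) ≠ 0) {m : ℕ} (h1 : 1 ≤ m) (r : ℕ) :
    pairWeight q m * ((tripleCoeff (q ^ 2) m ((r + 1 : ℕ) : ℤ)
        - tripleCoeff (q ^ 2) m (-((r + 1 : ℕ) : ℤ)))
      - q ^ (2 * r + 1) * (tripleCoeff (q ^ 2) m (r : ℤ) - tripleCoeff (q ^ 2) m (-(r : ℤ))))
      = pairCertificate q (m + 1) r - pairCertificate q m r := by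
  have hQ : q ^ 2 ≠ 0 := pow_ne_zero 2 hq
  rw [tripleCoeff_neg hQ, tripleCoeff_neg hQ]
  have a1 := tripleCoeff_add_one hQ m r
  have a2 := tripleCoeff_succ_mul hQ m r
  have a3 := pairWeight_succ hp hm h1
  rw [pairCertificate, pairCertificate]
  simp only [zpow_natCast] at a1 a2 ⊢
  push_cast
  have e4 : 1 + q * (q ^ 2) ^ m ≠ 0 := by
    have := hp (2 * m)
    rwa [pow_succ', pow_mul] at this
  -- The relation `a3` between consecutive weights carries the factor 1 + q^(2m+1); once it is
  -- present the identity is a polynomial combination of `a1`, `a2`, `a3`.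
  refine mul_left_cancel₀ e4 ?_
  generalize tripleCoeff (q ^ 2) m ((r : ℤ) + 1) = B at *
  generalize tripleCoeff (q ^ 2) m (r : ℤ) = A at *
  generalize tripleCoeff (q ^ 2) (m + 1) (r : ℤ) = C at *
  generalize pairWeight q (m + 1) = h' at *
  generalize pairWeight q m = h at *
  have p1 : (q ^ 2) ^ (r + 1) = (q ^ 2) ^ r * q ^ 2 := pow_succ _ _
  have p2 : (q ^ 2) ^ (m + 1) = (q ^ 2) ^ m * q ^ 2 := pow_succ _ _
  have p3 : (q ^ 2) ^ (2 * m + 2) = ((q ^ 2) ^ m * q ^ 2) ^ 2 := by ring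
  have p4 : q ^ (2 * r + 1) = (q ^ 2) ^ r * q := by rw [pow_succ, pow_mul]
  rw [p2, p3] at a2
  rw [p3] at a3
  rw [p1, p2, p4]
  generalize (q ^ 2) ^ r = v at *
  generalize (q ^ 2) ^ m = u at *
  linear_combination h * (1 + q * u - q ^ 2 * v + q ^ 2 * u * v) * a1
    + h' * (1 + q * u) * (1 + q * v) * a2 + (1 + q * v) * v * (A + q ^ 2 * u * B) * a3

theorem pairCertificate_one_zero {q : K} (hp : ∀ i, 1 + q ^ (i + 1) ≠ 0)
    (hm : ∀ i, 1 - q ^ (i + 1) ≠ 0) : pairCertificate q 1 0 = -q := by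
  have h1 := hp 0
  have h2 := hp 1
  have h3 := hm 1
  have h4 : tripleCoeff (q ^ 2) 1 0 = 1 + q ^ 2 := by
    rw [tripleCoeff_succ]
    simp [tripleCoeff, tripleSum]
  rw [pairCertificate, pairWeight]
  simp only [Finset.prod_range_succ, Finset.range_zero, Finset.prod_empty, Nat.cast_zero, h4]
  norm_num at h1 h2 h3 ⊢
  field_simp
  ring

theorem pairCertificate_one_succ (q : K) (r : ℕ) : pairCertificate q 1 (r + 1) = 0 := by
  rw [pairCertificate]
  rcases Nat.eq_zero_or_pos r with rfl | hr
  · simp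
  · rw [tripleCoeff_eq_zero, mul_zero]
    push_cast
    rw [abs_of_nonneg (by positivity)]
    omega

variable {O : Subring K} {q : K}

theorem pairWeight_mem (hqO : q ∈ O) (hinv : ∀ x ∈ O, (1 + q * x)⁻¹ ∈ O) {m : ℕ} (h1 : 1 ≤ m) :
    ∃ a ∈ O, pairWeight q m = q ^ m * a := by
  refine ⟨((1 - (q ^ 2) ^ m) * ∏ i ∈ Finset.range (2 * m), (1 + q ^ (i + 1)))⁻¹, ?_,
    div_eq_mul_inv _ _⟩
  rw [mul_inv]
  refine O.mul_mem ?_ ?_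
  · have := hinv (-q ^ (2 * m - 1)) (O.neg_mem (O.pow_mem hqO _))
    rwa [mul_neg, ← pow_succ', show 2 * m - 1 + 1 = 2 * m by omega, ← sub_eq_add_neg,
      pow_mul] at this
  · rw [← Finset.prod_inv_distrib]
    refine O.prod_mem fun i _ => ?_
    rw [pow_succ']
    exact hinv _ (O.pow_mem hqO _)

theorem pairCertificate_mem (hqO : q ∈ O) (hinv : ∀ x ∈ O, (1 + q * x)⁻¹ ∈ O) {m : ℕ}
    (h1 : 1 ≤ m) (r : ℕ) : ∃ a ∈ O, pairCertificate q m r = q ^ m * a := by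
  obtain ⟨a, ha, e⟩ := pairWeight_mem hqO hinv h1
  refine ⟨-(1 + q ^ (2 * r + 1)) * ((q ^ 2) ^ r - (q ^ 2) ^ m) * a * tripleCoeff (q ^ 2) m r,
    ?_, by rw [pairCertificate, e]; ring⟩
  have hQ := O.pow_mem hqO 2
  exact O.mul_mem (O.mul_mem (O.mul_mem (O.neg_mem (O.add_mem O.one_mem (O.pow_mem hqO _)))
    (O.sub_mem (O.pow_mem hQ _) (O.pow_mem hQ _))) ha) (tripleCoeff_mem hQ _ _)

/-- Summing the telescoping relation leaves two boundary terms. The one at M + 1 is divisible by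
q^(M+1); the one at 1 is nonzero only for r = 0, where it supplies the starting value q. The subring
`O` plays the role of the power series ring. -/
theorem sum_pairWeight_mul_tripleCoeff (hq : q ≠ 0) (hp : ∀ i, 1 + q ^ (i + 1) ≠ 0)
    (hm : ∀ i, 1 - q ^ (i + 1) ≠ 0) (hqO : q ∈ O) (hinv : ∀ x ∈ O, (1 + q * x)⁻¹ ∈ O)
    (M r : ℕ) : ∃ a ∈ O, ∑ m ∈ Finset.Icc 1 M, pairWeight q m *
      (tripleCoeff (q ^ 2) m ((r + 1 : ℕ) : ℤ) - tripleCoeff (q ^ 2) m (-((r + 1 : ℕ) : ℤ)))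
        = q ^ (r + 1) ^ 2 + q ^ (M + 1) * a := by
  have step : ∀ r : ℕ, ∑ m ∈ Finset.Icc 1 M, pairWeight q m *
      (tripleCoeff (q ^ 2) m ((r + 1 : ℕ) : ℤ) - tripleCoeff (q ^ 2) m (-((r + 1 : ℕ) : ℤ)))
      = q ^ (2 * r + 1) * ∑ m ∈ Finset.Icc 1 M, pairWeight q m *
        (tripleCoeff (q ^ 2) m (r : ℤ) - tripleCoeff (q ^ 2) m (-(r : ℤ)))
        + pairCertificate q (M + 1) r - pairCertificate q 1 r := by
    intro r
    have h : ∑ m ∈ Finset.Icc 1 M, (pairCertificate q (m + 1) r - pairCertificate q m r)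
        = pairCertificate q (M + 1) r - pairCertificate q 1 r := by
      induction M with
      | zero => simp
      | succ M ih => rw [Finset.sum_Icc_succ_top (by omega), ih]; ring
    rw [add_sub_assoc, ← h, Finset.mul_sum, ← Finset.sum_add_distrib]
    refine Finset.sum_congr rfl fun m hm' => ?_
    rw [← pairWeight_telescope hq hp hm (Finset.mem_Icc.1 hm').1]
    ring
  induction r with
  | zero =>
    obtain ⟨a, ha, e⟩ := pairCertificate_mem hqO hinv (Nat.le_add_left 1 M) 0
    refine ⟨a, ha, ?_⟩
    rw [step, e, pairCertificate_one_zero hp hm]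
    simp
    ring
  | succ r ih =>
    obtain ⟨a, ha, e⟩ := pairCertificate_mem hqO hinv (Nat.le_add_left 1 M) (r + 1)
    obtain ⟨b, hb, e'⟩ := ih
    refine ⟨q ^ (2 * (r + 1) + 1) * b + a, O.add_mem (O.mul_mem (O.pow_mem hqO _) hb) ha, ?_⟩
    rw [step, e, pairCertificate_one_succ, e']
    ring

end Telescoping

/-! ### Partial theta sums and the truncated identity -/

section PartialTheta

variable {K : Type*} [Field K]

/-- The truncated theta series `∑_{1 ≤ k ≤ r} (-1) ^ ⌊k / 2⌋ * Q ^ (⌊k / 2⌋ ^ 2)`. -/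
def partialTheta (Q : K) (r : ℕ) : K :=
  ∑ k ∈ Finset.Icc 1 r, (-1) ^ (k / 2) * Q ^ ((k / 2) ^ 2)

theorem partialTheta_succ (Q : K) (r : ℕ) :
    partialTheta Q (r + 1) = partialTheta Q r + evenTheta Q (r + 1) + evenTheta Q r := by
  rw [partialTheta, Finset.sum_Icc_succ_top (by omega), ← partialTheta, add_assoc]
  congr 1
  obtain ⟨s, rfl | rfl⟩ := r.even_or_odd'
  · have h1 : (2 * s + 1) / 2 = s := by omega
    have h2 := evenTheta_two_mul Q (s : ℤ)
    have h3 := evenTheta_two_mul_add_one Q (s : ℤ)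
    push_cast
    rw [h1, h2, h3]
    simp
  · have h1 : (2 * s + 1 + 1) / 2 = s + 1 := by omega
    have h2 := evenTheta_two_mul Q ((s : ℤ) + 1)
    have h3 := evenTheta_two_mul_add_one Q (s : ℤ)
    push_cast
    rw [h1, show (2 : ℤ) * s + 1 + 1 = 2 * (s + 1) by ring, h2, h3]
    have : ((s : ℤ) + 1).natAbs = s + 1 := by omega
    simp [this]

/-- The odd extension of `partialTheta` to the integers. -/
def oddTheta (Q : K) (r : ℤ) : K := (r.sign : K) * partialTheta Q r.natAbs

theorem oddTheta_natCast (Q : K) (r : ℕ) : oddTheta Q r = partialTheta Q r := by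
  rcases Nat.eq_zero_or_pos r with rfl | h
  · simp [oddTheta, partialTheta]
  · rw [oddTheta, Int.sign_eq_one_of_pos (by exact_mod_cast h)]
    simp

theorem oddTheta_neg (Q : K) (r : ℤ) : oddTheta Q (-r) = -oddTheta Q r := by
  simp [oddTheta, Int.sign_neg]

theorem oddTheta_add_one (Q : K) (r : ℤ) :
    oddTheta Q (r + 1) = oddTheta Q r + evenTheta Q (r + 1) + evenTheta Q r := by
  obtain ⟨n, rfl | rfl⟩ := r.eq_nat_or_neg
  · have h := oddTheta_natCast Q (n + 1)
    push_cast at h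
    rw [h, oddTheta_natCast, partialTheta_succ]
  · rcases n with _ | n
    · have h := oddTheta_natCast Q (0 + 1)
      have h0 := oddTheta_natCast Q 0
      have h2 := partialTheta_succ Q 0
      simp only [Nat.cast_zero, neg_zero, zero_add, Nat.cast_one] at *
      rw [h, h2, h0]
    · have h := oddTheta_natCast Q (n + 1)
      rw [show -((n + 1 : ℕ) : ℤ) + 1 = -(n : ℤ) by push_cast; ring, oddTheta_neg, oddTheta_neg,
        evenTheta_neg, evenTheta_neg, oddTheta_natCast, h, partialTheta_succ]
      push_cast
      ring

theorem partialTheta_mem {O : Subring K} {Q : K} (hQ : Q ∈ O) (r : ℕ) : partialTheta Q r ∈ O :=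
  O.sum_mem fun _ _ => O.mul_mem (O.pow_mem (O.neg_mem O.one_mem) _) (O.pow_mem hQ _)

theorem prod_range_two_mul (q : K) (m : ℕ) :
    ∏ i ∈ Finset.range (2 * m), (1 + q ^ (i + 1)) = (∏ i ∈ Finset.range m, (1 + q ^ (2 * i + 1)))
      * ∏ i ∈ Finset.range m, (1 + (q ^ 2) ^ (i + 1)) := by
  induction m with
  | zero => simp
  | succ m ih =>
    rw [show 2 * (m + 1) = 2 * m + 1 + 1 by ring, Finset.prod_range_succ, Finset.prod_range_succ,
      ih, Finset.prod_range_succ, Finset.prod_range_succ]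
    ring

/-- The truncations of `∑ q ^ m / ((1 + q ^ (2 * m)) * ∏_{i ≤ m} (1 + q ^ (2 * i - 1)))` and of
`∑ q ^ (r ^ 2) * partialTheta (q ^ 2) r` at `M` agree modulo `q ^ (M + 1)`. -/
theorem sum_eq_sum_partialTheta [CharZero K] {O : Subring K} {q : K} (hq : q ≠ 0)
    (hp : ∀ i, 1 + q ^ (i + 1) ≠ 0) (hm : ∀ i, 1 - q ^ (i + 1) ≠ 0) (hqO : q ∈ O)
    (hinv : ∀ x ∈ O, (1 + q * x)⁻¹ ∈ O) (M : ℕ) :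
    ∃ a ∈ O, ∑ m ∈ Finset.Icc 1 M,
        q ^ m / ((1 + q ^ (2 * m)) * ∏ i ∈ Finset.range m, (1 + q ^ (2 * i + 1)))
      = ∑ r ∈ Finset.Icc 1 M, q ^ r ^ 2 * partialTheta (q ^ 2) r + q ^ (M + 1) * a := by
  have hQ : q ^ 2 ≠ 0 := pow_ne_zero 2 hq
  have h0 : oddTheta (q ^ 2) 0 = 0 := by simp [oddTheta]
  have h1 : ∀ m ∈ Finset.Icc 1 M,
      q ^ m / ((1 + q ^ (2 * m)) * ∏ i ∈ Finset.range m, (1 + q ^ (2 * i + 1)))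
      = ∑ r ∈ Finset.Icc 1 M, partialTheta (q ^ 2) r * (pairWeight q m *
        (tripleCoeff (q ^ 2) m r - tripleCoeff (q ^ 2) m (-r))) := by
    intro m hmM
    obtain ⟨hm1, hmM⟩ := Finset.mem_Icc.1 hmM
    have h2 := tripleSum_odd (q ^ 2) hmM (oddTheta_neg (q ^ 2)) h0
    have h3 := tripleSum_of_increment hQ h0 (oddTheta_add_one (q ^ 2)) m
    have h4 : ∑ r ∈ Finset.Icc 1 M, partialTheta (q ^ 2) r * (pairWeight q m *
        (tripleCoeff (q ^ 2) m r - tripleCoeff (q ^ 2) m (-r)))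
        = pairWeight q m * tripleSum (q ^ 2) m (oddTheta (q ^ 2)) := by
      rw [h2, Finset.mul_sum]
      refine Finset.sum_congr rfl fun r _ => ?_
      rw [oddTheta_natCast]
      ring
    rw [h4, pairWeight, prod_range_two_mul]
    have e1 : (1 - (q ^ 2) ^ m) ≠ 0 := by
      have := hm (2 * m - 1)
      rwa [show 2 * m - 1 + 1 = 2 * m by omega, pow_mul] at this
    have e2 : (1 + (q ^ 2) ^ m) ≠ 0 := by
      have := hp (2 * m - 1)
      rwa [show 2 * m - 1 + 1 = 2 * m by omega, pow_mul] at this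
    have e3 : ∏ i ∈ Finset.range m, (1 + q ^ (2 * i + 1)) ≠ 0 :=
      Finset.prod_ne_zero_iff.2 fun i _ => hp _
    have e4 : ∏ i ∈ Finset.range m, (1 + (q ^ 2) ^ (i + 1)) ≠ 0 :=
      Finset.prod_ne_zero_iff.2 fun i _ => by
        rw [← pow_mul, show 2 * (i + 1) = 2 * i + 1 + 1 by ring]
        exact hp _
    rw [pow_mul]
    generalize ∏ i ∈ Finset.range m, (1 + q ^ (2 * i + 1)) = A at *
    generalize ∏ i ∈ Finset.range m, (1 + (q ^ 2) ^ (i + 1)) = B at *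
    generalize tripleSum (q ^ 2) m (oddTheta (q ^ 2)) = T at *
    generalize (q ^ 2) ^ m = u at *
    rw [div_eq_iff (mul_ne_zero e2 e3), div_mul_eq_mul_div, div_mul_eq_mul_div,
      eq_div_iff (mul_ne_zero e1 (mul_ne_zero e3 e4))]
    linear_combination -q ^ m * A * h3
  rw [Finset.sum_congr rfl h1, Finset.sum_comm]
  have h5 : ∀ r : ℕ, ∃ a ∈ O, r ∈ Finset.Icc 1 M → ∑ m ∈ Finset.Icc 1 M, partialTheta (q ^ 2) r *
      (pairWeight q m * (tripleCoeff (q ^ 2) m r - tripleCoeff (q ^ 2) m (-r)))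
      = q ^ r ^ 2 * partialTheta (q ^ 2) r + q ^ (M + 1) * a := by
    intro r
    rcases r with _ | r
    · exact ⟨0, O.zero_mem, by simp⟩
    · obtain ⟨a, ha, e⟩ := sum_pairWeight_mul_tripleCoeff hq hp hm hqO hinv M r
      refine ⟨partialTheta (q ^ 2) (r + 1) * a,
        O.mul_mem (partialTheta_mem (O.pow_mem hqO 2) _) ha, fun _ => ?_⟩
      rw [← Finset.mul_sum, e]
      ring
  choose a ha e using h5
  refine ⟨∑ r ∈ Finset.Icc 1 M, a r, O.sum_mem fun r _ => ha r, ?_⟩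
  rw [Finset.sum_congr rfl e, Finset.sum_add_distrib, Finset.mul_sum]

end PartialTheta

/-! ### Generating functions of the signed counts -/

section GeneratingFunction

open scoped PowerSeries.WithPiTopology

open PowerSeries (X)

/-- The parts allowed next to the distinguished part `l`. -/
def IsAdmissible (l k : ℕ) : Prop := (Odd k ∧ k < 2 * l) ∨ k = 2 * l

instance (l k : ℕ) : Decidable (IsAdmissible l k) := inferInstanceAs (Decidable (_ ∨ _))

/-- The signed count of partitions of `k` into parts admissible for `l`. -/
def signedCount (l k : ℕ) : ℤ :=
  ∑ p : k.Partition with ∀ i ∈ p.parts, IsAdmissible l i, (-1) ^ p.parts.card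

/-- Erasing and re-adjoining the distinguished part are inverse bijections. -/
theorem p₂_eq_sum_signedCount (n : ℕ) :
    p₂ n = ∑ l ∈ Finset.Icc 1 n, signedCount l (n - l) := by
  have h1 : p₂ n = ∑ l ∈ Finset.range (n + 1), ∑ μ : n.Partition with IsMarkedPartition μ l,
      (-1) ^ (μ.parts.erase l).card := by
    simp only [p₂, markedPartitions, Finset.sum_filter]
    rw [Finset.sum_product_right]
  rw [h1]
  symm
  refine Finset.sum_subset_zero_on_sdiff ?_ ?_ ?_
  · intro l hl
    simp only [Finset.mem_Icc, Finset.mem_range] at *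
    omega
  · intro l hl
    simp only [Finset.mem_sdiff, Finset.mem_Icc, Finset.mem_range] at hl
    obtain rfl : l = 0 := by omega
    rw [Finset.sum_eq_zero]
    intro μ hμ
    have := (Finset.mem_filter.1 hμ).2.1
    exact absurd (μ.parts_pos this) (lt_irrefl 0)
  · intro l hl
    obtain ⟨hl1, hln⟩ := Finset.mem_Icc.1 hl
    rw [signedCount]
    refine Finset.sum_bij'
      (fun (ν : (n - l).Partition) _ => (⟨l ::ₘ ν.parts, by
          intro i hi
          rcases Multiset.mem_cons.1 hi with rfl | hi
          · exact hl1
          · exact ν.parts_pos hi, by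
          rw [Multiset.sum_cons, ν.parts_sum]; omega⟩ : n.Partition))
      (fun (μ : n.Partition) (hμ : μ ∈ Finset.filter (fun μ => IsMarkedPartition μ l) _) =>
        (⟨μ.parts.erase l, fun {i} hi => μ.parts_pos (Multiset.mem_of_mem_erase hi), by
          have h := Multiset.cons_erase (Finset.mem_filter.1 hμ).2.1
          have h2 := congrArg Multiset.sum h
          rw [Multiset.sum_cons, μ.parts_sum] at h2
          omega⟩ : (n - l).Partition)) ?_ ?_ ?_ ?_ ?_
    · intro ν hν
      simp only [Finset.mem_filter, Finset.mem_univ, true_and] at hν ⊢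
      refine ⟨Multiset.mem_cons_self _ _, ?_⟩
      simpa [IsAdmissible] using hν
    · intro μ hμ
      simp only [Finset.mem_filter, Finset.mem_univ, true_and] at hμ ⊢
      exact hμ.2
    · intro ν hν
      ext1
      simp
    · intro μ hμ
      ext1
      exact Multiset.cons_erase (Finset.mem_filter.1 hμ).2.1
    · intro ν hν
      simp

theorem one_add_tsum_mul_one_add_X_pow {a : ℕ} (ha : a ≠ 0) :
    (1 + ∑' j : ℕ, (-1 : ℚ) ^ (j + 1) • (X : PowerSeries ℚ) ^ (a * (j + 1))) * (1 + X ^ a) = 1 := by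
  have hs : Summable fun j : ℕ => (-1 : ℚ) ^ (j + 1) • (X : PowerSeries ℚ) ^ (a * (j + 1)) :=
    Nat.Partition.summable_genFun_term' (fun _ c => (-1 : ℚ) ^ c) ha
  have h1 := hs.tsum_eq_zero_add
  have h2 : ∀ j : ℕ, (-1 : ℚ) ^ (j + 1 + 1) • (X : PowerSeries ℚ) ^ (a * (j + 1 + 1))
      = (-X ^ a) * ((-1 : ℚ) ^ (j + 1) • (X : PowerSeries ℚ) ^ (a * (j + 1))) := by
    intro j
    rw [mul_add a (j + 1) 1, pow_succ (-1 : ℚ) (j + 1), pow_add X]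
    simp only [mul_neg, mul_one, neg_smul, mul_smul_comm, neg_mul]
    rw [mul_comm, smul_neg]
  simp only [h2] at h1
  rw [hs.tsum_mul_left] at h1
  simp only [zero_add, pow_one, mul_one, neg_smul, one_smul] at h1
  linear_combination h1

theorem genFun_signedCount (l : ℕ) :
    Nat.Partition.genFun (fun i c => if IsAdmissible l i then (-1 : ℚ) ^ c else 0)
      = PowerSeries.mk fun k => (signedCount l k : ℚ) := by
  ext k
  rw [Nat.Partition.coeff_genFun, PowerSeries.coeff_mk, signedCount, Finset.sum_filter]
  push_cast
  refine Finset.sum_congr rfl fun p _ => ?_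
  rw [Finsupp.prod]
  simp only [Multiset.toFinsupp_support, Multiset.toFinsupp_apply]
  split_ifs with h
  · rw [Finset.prod_congr rfl (g := fun i => (-1 : ℚ) ^ p.parts.count i) fun i hi => by
      rw [if_pos (h i (Multiset.mem_toFinset.1 hi))]]
    rw [Finset.prod_pow_eq_pow_sum, Multiset.toFinset_sum_count_eq]
  · push Not at h
    obtain ⟨i, hi, h⟩ := h
    exact Finset.prod_eq_zero (Multiset.mem_toFinset.2 hi) (if_neg h)

theorem mk_signedCount_mul {l : ℕ} (hl : 1 ≤ l) :
    (PowerSeries.mk fun k => (signedCount l k : ℚ)) *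
      ((1 + X ^ (2 * l)) * ∏ i ∈ Finset.range l, (1 + X ^ (2 * i + 1))) = 1 := by
  rw [← genFun_signedCount]
  set f : ℕ → ℕ → ℚ := fun i c => if IsAdmissible l i then (-1 : ℚ) ^ c else 0 with hf
  have h1 := Nat.Partition.hasProd_genFun f
  -- Factor i of the product belongs to the part i + 1: odd parts 2i + 1 have index 2i, and the part
  -- 2l has index 2l - 1.
  set s : Finset ℕ := (Finset.range l).image (fun i => 2 * i) with hs
  have hnot : (2 * l - 1) ∉ s := by
    simp only [hs, Finset.mem_image, not_exists, not_and, Finset.mem_range]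
    omega
  have h2 := hasProd_prod_of_ne_finset_one (L := .unconditional ℕ) (s := insert (2 * l - 1) s)
    (f := fun i ↦ 1 + ∑' j, f (i + 1) (j + 1) • (X : PowerSeries ℚ) ^ ((i + 1) * (j + 1))) (by
      intro i hi
      have hadm : ¬ IsAdmissible l (i + 1) := by
        rintro (⟨⟨t, ht⟩, h⟩ | h)
        · refine hi (Finset.mem_insert_of_mem (Finset.mem_image.2 ⟨t, ?_, by omega⟩))
          rw [Finset.mem_range]
          omega
        · exact hi (Finset.mem_insert.2 (Or.inl (by omega)))
      simp [hf, hadm])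
  have hadm : ∀ i, IsAdmissible l (i + 1) → (1 + ∑' j, f (i + 1) (j + 1) •
      (X : PowerSeries ℚ) ^ ((i + 1) * (j + 1))) * (1 + X ^ (i + 1)) = 1 := by
    intro i hi
    simp only [hf, if_pos hi]
    exact one_add_tsum_mul_one_add_X_pow (Nat.succ_ne_zero i)
  rw [h1.unique h2, Finset.prod_insert hnot, hs, Finset.prod_image (by intro a _ b _ h; simpa using h),
    mul_mul_mul_comm, ← Finset.prod_mul_distrib]
  have e1 := hadm (2 * l - 1) (Or.inr (by omega))
  rw [show 2 * l - 1 + 1 = 2 * l by omega] at e1 ⊢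
  rw [e1, one_mul]
  refine Finset.prod_eq_one fun i hi => hadm (2 * i) (Or.inl ⟨⟨i, rfl⟩, ?_⟩)
  have := Finset.mem_range.1 hi
  omega

end GeneratingFunction

/-! ### Passage to coefficients -/

section Coefficients

open PowerSeries (X)

/-- The field identity is applied with `O` the image of ℚ⟦X⟧ in its fraction field: 1 + X p has
constant term 1, hence is a unit of ℚ⟦X⟧. -/
theorem X_pow_dvd_sum_sub_sum (M : ℕ) :
    (X : PowerSeries ℚ) ^ (M + 1) ∣ ∑ l ∈ Finset.Icc 1 M,
        X ^ l * (PowerSeries.mk fun k => (signedCount l k : ℚ))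
      - ∑ r ∈ Finset.Icc 1 M, ∑ k ∈ Finset.Icc 1 r,
        X ^ r ^ 2 * ((-1) ^ (k / 2) * (X ^ 2) ^ (k / 2) ^ 2) := by
  obtain ⟨K, _, φ, hinj⟩ : ∃ (K : Type) (_ : Field K) (φ : PowerSeries ℚ →+* K),
      Function.Injective φ :=
    ⟨FractionRing (PowerSeries ℚ), inferInstance, algebraMap _ _, IsFractionRing.injective _ _⟩
  have : CharZero K := charZero_of_injective_ringHom (f := φ.comp PowerSeries.C)
    (hinj.comp PowerSeries.C_injective)
  have hunit : ∀ p : PowerSeries ℚ, φ (1 + X * p) ≠ 0 := by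
    intro p h
    rw [map_eq_zero_iff φ hinj] at h
    have := congrArg PowerSeries.constantCoeff h
    simp at this
  obtain ⟨a, ha, e⟩ := sum_eq_sum_partialTheta (O := φ.range) (q := φ X)
    (by rw [Ne, map_eq_zero_iff φ hinj]; exact PowerSeries.X_ne_zero)
    (fun i => by
      have h := hunit (X ^ i)
      rwa [← pow_succ', map_add, map_one, map_pow] at h)
    (fun i => by
      have h := hunit (-X ^ i)
      rwa [mul_neg, ← pow_succ', ← sub_eq_add_neg, map_sub, map_one, map_pow] at h) ⟨X, rfl⟩ (by
      rintro _ ⟨p, rfl⟩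
      refine ⟨(1 + X * p)⁻¹, ?_⟩
      rw [← map_mul, ← map_one φ, ← map_add]
      refine eq_inv_of_mul_eq_one_left ?_
      rw [← map_mul, PowerSeries.inv_mul_cancel _ (by simp), map_one]) M
  obtain ⟨a, rfl⟩ := ha
  refine ⟨a, hinj ?_⟩
  rw [map_sub, map_mul, map_pow, sub_eq_iff_eq_add']
  have h1 : φ (∑ l ∈ Finset.Icc 1 M, X ^ l * (PowerSeries.mk fun k => (signedCount l k : ℚ)))
      = ∑ m ∈ Finset.Icc 1 M, φ X ^ m /
        ((1 + φ X ^ (2 * m)) * ∏ i ∈ Finset.range m, (1 + φ X ^ (2 * i + 1))) := by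
    rw [map_sum]
    refine Finset.sum_congr rfl fun l hl => ?_
    have h := congrArg φ (mk_signedCount_mul (Finset.mem_Icc.1 hl).1)
    simp only [map_mul, map_add, map_one, map_pow, map_prod] at h ⊢
    rw [div_eq_mul_inv, eq_inv_of_mul_eq_one_left h]
  rw [h1, e]
  congr 1
  simp only [map_sum, map_mul, map_pow, map_neg, map_one, partialTheta, Finset.mul_sum]

/-- The signed count as a sum over a cone of representations by the form `x ^ 2 + 2 * y ^ 2`. -/
theorem p₂_eq_sum (n : ℕ) :
    p₂ n = ∑ r ∈ Finset.Icc 1 n, ∑ k ∈ Finset.Icc 1 r,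
      if n = r ^ 2 + 2 * (k / 2) ^ 2 then (-1) ^ (k / 2) else 0 := by
  have h := PowerSeries.X_pow_dvd_iff.1 (X_pow_dvd_sum_sub_sum n) n (Nat.lt_succ_self n)
  rw [map_sub, sub_eq_zero, map_sum, map_sum] at h
  have h1 : ∀ l ∈ Finset.Icc 1 n, PowerSeries.coeff n
      (X ^ l * (PowerSeries.mk fun k => (signedCount l k : ℚ))) = (signedCount l (n - l) : ℚ) := by
    intro l hl
    rw [PowerSeries.coeff_X_pow_mul', if_pos (Finset.mem_Icc.1 hl).2, PowerSeries.coeff_mk]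
  have h2 : ∀ r k : ℕ, PowerSeries.coeff n
      ((X : PowerSeries ℚ) ^ r ^ 2 * ((-1) ^ (k / 2) * (X ^ 2) ^ (k / 2) ^ 2))
      = if n = r ^ 2 + 2 * (k / 2) ^ 2 then (-1) ^ (k / 2) else 0 := by
    intro r k
    have : (X : PowerSeries ℚ) ^ r ^ 2 * ((-1) ^ (k / 2) * (X ^ 2) ^ (k / 2) ^ 2)
        = PowerSeries.C ((-1) ^ (k / 2)) * X ^ (r ^ 2 + 2 * (k / 2) ^ 2) := by
      rw [← pow_mul, pow_add, map_pow, map_neg, map_one]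
      ring
    rw [this, PowerSeries.coeff_C_mul, PowerSeries.coeff_X_pow]
    simp
  rw [Finset.sum_congr rfl h1] at h
  simp only [map_sum, h2] at h
  rw [p₂_eq_sum_signedCount]
  exact_mod_cast h

end Coefficients

/-! ### Arithmetic of the form x² + 2y² -/

section SplitNumbers

/-- A positive integer all of whose prime factors are congruent to `1` or `3` modulo `8`. -/
def IsSplit (n : ℕ) : Prop := 0 < n ∧ ∀ p : ℕ, p.Prime → p ∣ n → p % 8 = 1 ∨ p % 8 = 3

theorem IsSplit.of_dvd {m n : ℕ} (hn : IsSplit n) (h : m ∣ n) : IsSplit m :=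
  ⟨Nat.pos_of_dvd_of_pos h hn.1, fun p hp hpm => hn.2 p hp (hpm.trans h)⟩

theorem IsSplit.mul {m n : ℕ} (hm : IsSplit m) (hn : IsSplit n) : IsSplit (m * n) :=
  ⟨Nat.mul_pos hm.1 hn.1, fun p hp h => (hp.dvd_mul.1 h).elim (hm.2 p hp) (hn.2 p hp)⟩

theorem IsSplit.χ₈'_eq_one {n : ℕ} (hn : IsSplit n) : ZMod.χ₈' n = 1 := by
  induction n using Nat.recOnMul with
  | zero => exact absurd hn.1 (lt_irrefl 0)
  | one => simp
  | prime p hp =>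
    rw [ZMod.χ₈'_nat_eq_if_mod_eight]
    have h := hn.2 p hp dvd_rfl
    rw [if_neg (by omega), if_pos h]
  | mul a b ha hb =>
    rw [Nat.cast_mul, map_mul, ha (hn.of_dvd (dvd_mul_right _ _)),
      hb (hn.of_dvd (dvd_mul_left _ _)), one_mul]

/-- For a prime p dividing the value, coprimality makes y invertible mod p, so (x/y)² = -2 mod p. -/
theorem isSplit_sq_add_two_mul_sq {x y : ℕ} (hxy : x.Coprime y) (hx : Odd x) :
    IsSplit (x ^ 2 + 2 * y ^ 2) := by
  refine ⟨by have := hx.pos; positivity, fun p hp hpn => ?_⟩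
  have : Fact p.Prime := ⟨hp⟩
  have hp2 : p ≠ 2 := by
    rintro rfl
    have h1 : Odd (x ^ 2 + 2 * y ^ 2) := (hx.pow).add_even (even_two_mul _)
    exact (Nat.not_even_iff_odd.2 h1) (even_iff_two_dvd.2 hpn)
  refine (ZMod.exists_sq_eq_neg_two_iff hp2).1 ?_
  have h0 : (x : ZMod p) ^ 2 + 2 * (y : ZMod p) ^ 2 = 0 := by
    exact_mod_cast (ZMod.natCast_eq_zero_iff _ _).2 hpn
  have hy : (y : ZMod p) ≠ 0 := by
    intro hy
    have hpy : p ∣ y := (ZMod.natCast_eq_zero_iff _ _).1 hy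
    rw [hy] at h0
    have hx0 : (x : ZMod p) = 0 := by simpa using h0
    have hpx : p ∣ x := (ZMod.natCast_eq_zero_iff _ _).1 hx0
    exact Nat.not_coprime_of_dvd_of_dvd hp.one_lt hpx hpy hxy
  refine ⟨x / y, ?_⟩
  field_simp
  linear_combination -h0

/-- Here g = gcd(x, y). If x/g is even, a factor 2 splits off and the two variables exchange roles.
-/
theorem exists_eq_mul_sq_mul_isSplit {n x y : ℕ} (hn : 0 < n) (h : n = x ^ 2 + 2 * y ^ 2) :
    ∃ c ∈ ({1, 2} : Finset ℕ), ∃ g m : ℕ, 0 < g ∧ IsSplit m ∧ n = c * g ^ 2 * m := by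
  have hg : 0 < Nat.gcd x y := by
    rw [Nat.pos_iff_ne_zero]
    intro h0
    rw [Nat.gcd_eq_zero_iff] at h0
    simp [h, h0.1, h0.2] at hn
  obtain ⟨g, a, b, hg0, hab, rfl, rfl⟩ := Nat.exists_coprime' hg
  rcases Nat.even_or_odd' a with ⟨t, rfl | rfl⟩
  · have hb : Odd b := by
      by_contra hb
      rw [Nat.not_odd_iff_even] at hb
      exact Nat.not_coprime_of_dvd_of_dvd one_lt_two (dvd_mul_right _ _) hb.two_dvd hab
    refine ⟨2, by simp, g, b ^ 2 + 2 * t ^ 2, hg0,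
      isSplit_sq_add_two_mul_sq (Nat.Coprime.coprime_mul_left hab).symm hb, ?_⟩
    rw [h]
    ring
  · refine ⟨1, by simp, g, _, hg0, isSplit_sq_add_two_mul_sq hab ⟨t, rfl⟩, ?_⟩
    rw [h]
    ring

end SplitNumbers

/-! ### The quadratic character χ₈' -/

section CharacterSums

theorem sum_divisors_χ₈'_nonneg (n : ℕ) : 0 ≤ ∑ d ∈ n.divisors, ZMod.χ₈' (d : ZMod 8) := by
  set χ : DirichletCharacter ℂ 8 := ZMod.χ₈'.ringHomComp (Int.castRingHom ℂ) with hχ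
  have hq : χ ^ 2 = 1 := by
    rw [← MulChar.isQuadratic_iff_sq_eq_one]
    exact ZMod.isQuadratic_χ₈'.comp _
  have h := DirichletCharacter.zetaMul_nonneg hq n
  rw [DirichletCharacter.zetaMul, ArithmeticFunction.coe_zeta_mul_apply] at h
  have h2 : ∑ i ∈ n.divisors, (toArithmeticFunction (χ ·)) i
      = (((∑ d ∈ n.divisors, ZMod.χ₈' (d : ZMod 8) : ℤ) : ℝ) : ℂ) := by
    push_cast
    refine Finset.sum_congr rfl fun d hd => ?_
    have : d ≠ 0 := (Nat.pos_of_mem_divisors hd).ne'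
    simp [toArithmeticFunction, this, hχ]
  rw [h2] at h
  exact_mod_cast h

theorem sum_χ₈'_le_two (N : ℕ) : ∑ m ∈ Finset.Ioc 0 N, ZMod.χ₈' (m : ZMod 8) ≤ 2 := by
  have key : ∑ m ∈ Finset.Ioc 0 N, ZMod.χ₈' (m : ZMod 8) =
      if N % 8 = 0 ∨ N % 8 = 7 then 0 else if N % 8 = 3 ∨ N % 8 = 4 then 2 else 1 := by
    induction N with
    | zero => simp
    | succ N ih =>
      rw [Finset.sum_Ioc_succ_top (Nat.zero_le N), ih, ZMod.χ₈'_nat_eq_if_mod_eight]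
      split_ifs <;> omega
  rw [key]
  split_ifs <;> norm_num

/-- Partial summation from S(N) = ∑_{m ≤ N} χ₈'(m) ≤ 2: adding (2 - S(N))/(N + 1) makes a quantity
that is nonincreasing in N and equals 2 at N = 0. -/
theorem sum_χ₈'_div_le_two (N : ℕ) :
    ∑ m ∈ Finset.Ioc 0 N, (ZMod.χ₈' (m : ZMod 8) : ℝ) / m ≤ 2 := by
  have key : ∑ m ∈ Finset.Ioc 0 N, (ZMod.χ₈' (m : ZMod 8) : ℝ) / m
      + (2 - ∑ m ∈ Finset.Ioc 0 N, (ZMod.χ₈' (m : ZMod 8) : ℝ)) / (N + 1) ≤ 2 := by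
    induction N with
    | zero => simp
    | succ N ih =>
      have h2 : ∑ m ∈ Finset.Ioc 0 (N + 1), (ZMod.χ₈' (m : ZMod 8) : ℝ) ≤ 2 := by
        exact_mod_cast sum_χ₈'_le_two (N + 1)
      have h3 : (2 - ∑ m ∈ Finset.Ioc 0 (N + 1), (ZMod.χ₈' (m : ZMod 8) : ℝ))
          / (((N + 1 : ℕ) : ℝ) + 1) ≤
          (2 - ∑ m ∈ Finset.Ioc 0 (N + 1), (ZMod.χ₈' (m : ZMod 8) : ℝ)) / (N + 1) := by
        refine div_le_div_of_nonneg_left (by linarith) (by positivity) ?_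
        push_cast
        linarith
      refine le_trans (add_le_add_right h3 _) (le_trans (le_of_eq ?_) ih)
      simp only [Finset.sum_Ioc_succ_top (Nat.zero_le N)]
      push_cast
      field_simp
      ring
  have h2 : ∑ m ∈ Finset.Ioc 0 N, (ZMod.χ₈' (m : ZMod 8) : ℝ) ≤ 2 := by
    exact_mod_cast sum_χ₈'_le_two N
  have : 0 ≤ (2 - ∑ m ∈ Finset.Ioc 0 N, (ZMod.χ₈' (m : ZMod 8) : ℝ)) / (N + 1) :=
    div_nonneg (by linarith) (by positivity)
  linarith

end CharacterSums

/-! ### Sums over split integers -/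

section SplitSums

theorem sum_divisors_eq_sum_antidiagonal_snd (n : ℕ) (f : ℕ → ℝ) :
    ∑ d ∈ n.divisors, f d = ∑ x ∈ n.divisorsAntidiagonal, f x.2 :=
  (Nat.sum_divisorsAntidiagonal' (f := fun _ b => f b)).symm

open Classical in
/-- The indicator function of `IsSplit`. -/
noncomputable def splitIndicator : ArithmeticFunction ℝ :=
  ⟨fun n => if IsSplit n then 1 else 0, if_neg fun h => lt_irrefl 0 h.1⟩

theorem splitIndicator_of_isSplit {n : ℕ} (h : IsSplit n) : splitIndicator n = 1 := if_pos h

theorem splitIndicator_of_not {n : ℕ} (h : ¬ IsSplit n) : splitIndicator n = 0 := if_neg h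

theorem splitIndicator_nonneg (n : ℕ) : 0 ≤ splitIndicator n := by
  by_cases h : IsSplit n
  · rw [splitIndicator_of_isSplit h]; exact zero_le_one
  · rw [splitIndicator_of_not h]

/-- The reciprocals of the integers `IsSplit`, extended by zero. -/
noncomputable def splitInv : ArithmeticFunction ℝ :=
  ⟨fun n => splitIndicator n / n, by simp⟩

theorem splitInv_apply (n : ℕ) : splitInv n = splitIndicator n / n := rfl

theorem splitInv_nonneg (n : ℕ) : 0 ≤ splitInv n :=
  div_nonneg (splitIndicator_nonneg n) (Nat.cast_nonneg n)

/-- The partial sums of the reciprocals of the integers `IsSplit`. -/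
noncomputable def splitHarmonic (N : ℕ) : ℝ := ∑ m ∈ Finset.Ioc 0 N, splitInv m

theorem splitHarmonic_nonneg (N : ℕ) : 0 ≤ splitHarmonic N :=
  Finset.sum_nonneg fun m _ => splitInv_nonneg m

theorem splitHarmonic_mono : Monotone splitHarmonic := fun _ _ h =>
  Finset.sum_le_sum_of_subset_of_nonneg (Finset.Ioc_subset_Ioc_right h)
    fun m _ _ => splitInv_nonneg m

/-- Pointwise b * b ≤ 1 * χ₈', divided by n. For split n all divisors are split with χ₈' = 1, giving
equality; otherwise the left side vanishes and 1 * χ₈' ≥ 0. -/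
theorem splitInv_mul_splitInv_le (n : ℕ) :
    (splitInv * splitInv) n ≤ ∑ x ∈ n.divisorsAntidiagonal,
      (1 / (x.1 : ℝ)) * ((ZMod.χ₈' (x.2 : ZMod 8) : ℝ) / x.2) := by
  rw [ArithmeticFunction.mul_apply]
  by_cases hn : IsSplit n
  · refine le_of_eq (Finset.sum_congr rfl fun x hx => ?_)
    have hx' := (Nat.mem_divisorsAntidiagonal.1 hx).1
    have h1 : IsSplit x.1 := hn.of_dvd ⟨_, hx'.symm⟩
    have h2 : IsSplit x.2 := hn.of_dvd ⟨x.1, by rw [← hx', mul_comm]⟩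
    rw [splitInv_apply, splitInv_apply, splitIndicator_of_isSplit h1,
      splitIndicator_of_isSplit h2, h2.χ₈'_eq_one, Int.cast_one]
  · rw [Finset.sum_eq_zero]
    · have h : ∑ x ∈ n.divisorsAntidiagonal,
          (1 / (x.1 : ℝ)) * ((ZMod.χ₈' (x.2 : ZMod 8) : ℝ) / x.2)
          = ((∑ d ∈ n.divisors, ZMod.χ₈' (d : ZMod 8) : ℤ) : ℝ) / n := by
        push_cast
        rw [sum_divisors_eq_sum_antidiagonal_snd n (fun d => (ZMod.χ₈' (d : ZMod 8) : ℝ)),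
          Finset.sum_div]
        refine Finset.sum_congr rfl fun x hx => ?_
        rw [← (Nat.mem_divisorsAntidiagonal.1 hx).1]
        push_cast
        rw [div_mul_div_comm, one_mul]
      rw [h]
      exact div_nonneg (by exact_mod_cast sum_divisors_χ₈'_nonneg n) (Nat.cast_nonneg n)
    · intro x hx
      rw [splitInv_apply, splitInv_apply]
      by_cases h1 : IsSplit x.1
      · by_cases h2 : IsSplit x.2
        · exact absurd ((Nat.mem_divisorsAntidiagonal.1 hx).1 ▸ h1.mul h2) hn
        · rw [splitIndicator_of_not h2]; simp
      · rw [splitIndicator_of_not h1]; simp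

theorem sum_Ioc_one_div_le (N : ℕ) : ∑ m ∈ Finset.Ioc 0 N, 1 / (m : ℝ) ≤ 1 + Real.log N := by
  have h := harmonic_le_one_add_log N
  rw [harmonic_eq_sum_Icc] at h
  push_cast at h
  rw [← Finset.Icc_add_one_left_eq_Ioc]
  simpa [one_div] using h

/-- The square [1, N]² lies under the hyperbola de ≤ N², so the convolution bound applies up to N²;
the inner character sums are at most 2. -/
theorem splitHarmonic_sq_le (N : ℕ) : splitHarmonic N ^ 2 ≤ 2 + 4 * Real.log N := by
  have h1 : splitHarmonic N ^ 2 ≤ ∑ n ∈ Finset.Ioc 0 (N ^ 2), (splitInv * splitInv) n := by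
    rw [ArithmeticFunction.sum_Ioc_mul_eq_sum_sum, sq, splitHarmonic, Finset.sum_mul]
    refine le_trans (Finset.sum_le_sum (g := fun n => splitInv n *
      ∑ m ∈ Finset.Ioc 0 (N ^ 2 / n), splitInv m) fun n hn => ?_)
      (Finset.sum_le_sum_of_subset_of_nonneg (Finset.Ioc_subset_Ioc_right ?_) fun n _ _ => ?_)
    · refine mul_le_mul_of_nonneg_left (splitHarmonic_mono ?_) (splitInv_nonneg n)
      obtain ⟨hn0, hnN⟩ := Finset.mem_Ioc.1 hn
      rw [Nat.le_div_iff_mul_le hn0, sq]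
      exact Nat.mul_le_mul_left _ hnN
    · exact Nat.le_self_pow two_ne_zero N
    · exact mul_nonneg (splitInv_nonneg n) (splitHarmonic_nonneg _)
  let f : ArithmeticFunction ℝ := ⟨fun n => 1 / (n : ℝ), by simp⟩
  let g : ArithmeticFunction ℝ := ⟨fun n => (ZMod.χ₈' (n : ZMod 8) : ℝ) / n, by simp⟩
  have h2 : ∑ n ∈ Finset.Ioc 0 (N ^ 2), (splitInv * splitInv) n
      ≤ ∑ n ∈ Finset.Ioc 0 (N ^ 2), (f * g) n := by
    refine Finset.sum_le_sum fun n _ => (splitInv_mul_splitInv_le n).trans (le_of_eq ?_)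
    rw [ArithmeticFunction.mul_apply]
    rfl
  rw [ArithmeticFunction.sum_Ioc_mul_eq_sum_sum f g] at h2
  have h3 : ∑ n ∈ Finset.Ioc 0 (N ^ 2), f n * ∑ m ∈ Finset.Ioc 0 (N ^ 2 / n), g m
      ≤ ∑ n ∈ Finset.Ioc 0 (N ^ 2), f n * 2 := by
    refine Finset.sum_le_sum fun n _ => mul_le_mul_of_nonneg_left (sum_χ₈'_div_le_two _) ?_
    exact one_div_nonneg.2 (Nat.cast_nonneg n)
  have h4 : ∑ n ∈ Finset.Ioc 0 (N ^ 2), f n ≤ 1 + Real.log ((N ^ 2 : ℕ) : ℝ) :=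
    sum_Ioc_one_div_le (N ^ 2)
  rw [← Finset.sum_mul] at h3
  push_cast at h4
  rw [Real.log_pow] at h4
  push_cast at h4
  linarith

/-- Expand log m = ∑_{d ∣ m} Λ(d), use b(m) ≤ b(m/d), and bound the sums of Λ by Chebyshev. -/
theorem sum_splitIndicator_mul_log_le (N : ℕ) :
    ∑ m ∈ Finset.Ioc 0 N, splitIndicator m * Real.log m
      ≤ (Real.log 4 + 4) * N * splitHarmonic N := by
  have h1 : ∑ m ∈ Finset.Ioc 0 N, splitIndicator m * Real.log m ≤
      ∑ m ∈ Finset.Ioc 0 N, (splitIndicator * ArithmeticFunction.vonMangoldt) m := by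
    refine Finset.sum_le_sum fun m _ => ?_
    rw [ArithmeticFunction.mul_apply, ← ArithmeticFunction.vonMangoldt_sum,
      sum_divisors_eq_sum_antidiagonal_snd, Finset.mul_sum]
    refine Finset.sum_le_sum fun x hx => mul_le_mul_of_nonneg_right ?_
      ArithmeticFunction.vonMangoldt_nonneg
    by_cases hm : IsSplit m
    · have h1 : IsSplit x.1 := hm.of_dvd ⟨_, (Nat.mem_divisorsAntidiagonal.1 hx).1.symm⟩
      rw [splitIndicator_of_isSplit hm, splitIndicator_of_isSplit h1]
    · rw [splitIndicator_of_not hm]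
      exact splitIndicator_nonneg _
  rw [ArithmeticFunction.sum_Ioc_mul_eq_sum_sum] at h1
  refine h1.trans ?_
  rw [splitHarmonic, Finset.mul_sum]
  refine Finset.sum_le_sum fun n hn => ?_
  have h2 : ∑ m ∈ Finset.Ioc 0 (N / n), ArithmeticFunction.vonMangoldt m
      ≤ (Real.log 4 + 4) * (N / n) := by
    have h := Chebyshev.psi_le_const_mul_self (x := (N : ℝ) / n) (by positivity)
    rwa [Chebyshev.psi, Nat.floor_div_natCast, Nat.floor_natCast] at h
  calc splitIndicator n * ∑ m ∈ Finset.Ioc 0 (N / n), ArithmeticFunction.vonMangoldt m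
      ≤ splitIndicator n * ((Real.log 4 + 4) * (N / n)) :=
        mul_le_mul_of_nonneg_left h2 (splitIndicator_nonneg n)
    _ = (Real.log 4 + 4) * N * splitInv n := by rw [splitInv_apply]; ring

end SplitSums

/-! ### Landau's upper bound -/

section RepresentedNumbers

open Classical in
/-- The number of positive integers up to `N` of the form `x ^ 2 + 2 * y ^ 2`. -/
noncomputable def representedCount (N : ℕ) : ℕ :=
  ((Finset.Ioc 0 N).filter fun n => ∃ x y : ℕ, n = x ^ 2 + 2 * y ^ 2).card

theorem representedCount_le (N : ℕ) : representedCount N ≤ N := by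
  classical
  exact (Finset.card_filter_le _ _).trans (by simp)

theorem representedCount_le_sum (N : ℕ) : (representedCount N : ℝ) ≤
    2 * ∑ g ∈ Finset.Ioc 0 N.sqrt, ∑ m ∈ Finset.Ioc 0 (N / g ^ 2), splitIndicator m := by
  classical
  have hsub : ((Finset.Ioc 0 N).filter fun n => ∃ x y : ℕ, n = x ^ 2 + 2 * y ^ 2) ⊆
      ({1, 2} : Finset ℕ).biUnion fun c => (Finset.Ioc 0 N.sqrt).biUnion fun g =>
        ((Finset.Ioc 0 (N / g ^ 2)).filter IsSplit).image fun m => c * g ^ 2 * m := by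
    intro n hn
    obtain ⟨hn, x, y, hxy⟩ := Finset.mem_filter.1 hn
    obtain ⟨hn0, hnN⟩ := Finset.mem_Ioc.1 hn
    obtain ⟨c, hc, g, m, hg, hm, rfl⟩ := exists_eq_mul_sq_mul_isSplit hn0 hxy
    have hc1 : 1 ≤ c := by
      simp only [Finset.mem_insert, Finset.mem_singleton] at hc
      omega
    have h1 : m * g ^ 2 ≤ N := by
      calc m * g ^ 2 = 1 * g ^ 2 * m := by ring
        _ ≤ c * g ^ 2 * m := by gcongr
        _ ≤ N := hnN
    have hm1 : 1 ≤ m := hm.1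
    have h2 : g * g ≤ N := by
      calc g * g = 1 * g ^ 2 := by ring
        _ ≤ m * g ^ 2 := by gcongr
        _ ≤ N := h1
    refine Finset.mem_biUnion.2 ⟨c, hc, Finset.mem_biUnion.2 ⟨g, ?_, Finset.mem_image.2
      ⟨m, Finset.mem_filter.2 ⟨Finset.mem_Ioc.2 ⟨hm1, ?_⟩, hm⟩, rfl⟩⟩⟩
    · exact Finset.mem_Ioc.2 ⟨hg, Nat.le_sqrt.2 h2⟩
    · exact (Nat.le_div_iff_mul_le (by positivity)).2 h1
  have hcard : representedCount N ≤ ∑ _c ∈ ({1, 2} : Finset ℕ), ∑ g ∈ Finset.Ioc 0 N.sqrt,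
      ((Finset.Ioc 0 (N / g ^ 2)).filter IsSplit).card := by
    refine (Finset.card_le_card hsub).trans (Finset.card_biUnion_le.trans
      (Finset.sum_le_sum fun c _ => Finset.card_biUnion_le.trans
        (Finset.sum_le_sum fun g _ => Finset.card_image_le)))
  rw [Finset.sum_const, Finset.card_pair (by decide : (1 : ℕ) ≠ 2), smul_eq_mul] at hcard
  refine le_trans (Nat.cast_le.2 hcard) (le_of_eq ?_)
  push_cast
  congr 1
  refine Finset.sum_congr rfl fun g _ => ?_
  rw [Finset.card_filter]
  push_cast
  rfl

/-- Those m ≤ N^(1/4) are counted trivially; for larger m, log m ≥ (log N)/4. The threshold depends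
on N, not on k, so it serves all k = N/g² at once. -/
theorem sum_splitIndicator_le {N : ℕ} (hN : 2 ≤ N) (k : ℕ) :
    ∑ m ∈ Finset.Ioc 0 k, splitIndicator m ≤ N.sqrt.sqrt
      + 4 / Real.log N * ∑ m ∈ Finset.Ioc 0 k, splitIndicator m * Real.log m := by
  have hlog : 0 < Real.log N := Real.log_pos (by exact_mod_cast hN)
  set t := N.sqrt.sqrt with ht
  have h1 : ∀ m ∈ Finset.Ioc 0 k, splitIndicator m ≤ (if m ∈ Finset.Ioc 0 t then (1 : ℝ) else 0)
      + 4 / Real.log N * (splitIndicator m * Real.log m) := by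
    intro m hm
    have hm0 : 1 ≤ m := (Finset.mem_Ioc.1 hm).1
    have hlm : 0 ≤ Real.log m := Real.log_natCast_nonneg m
    have hnn : 0 ≤ 4 / Real.log N * (splitIndicator m * Real.log m) :=
      mul_nonneg (by positivity) (mul_nonneg (splitIndicator_nonneg m) hlm)
    by_cases hmt : m ≤ t
    · rw [if_pos (Finset.mem_Ioc.2 ⟨hm0, hmt⟩)]
      have : splitIndicator m ≤ 1 := by
        by_cases h : IsSplit m
        · rw [splitIndicator_of_isSplit h]
        · rw [splitIndicator_of_not h]; exact zero_le_one
      linarith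
    · rw [if_neg (fun h => hmt (Finset.mem_Ioc.1 h).2), zero_add]
      have h2 : N < m ^ 4 := by
        have a1 : N.sqrt < m * m := Nat.sqrt_lt.1 (lt_of_not_ge hmt)
        have a2 : N < (m * m) * (m * m) := Nat.sqrt_lt.1 a1
        calc N < (m * m) * (m * m) := a2
          _ = m ^ 4 := by ring
      have h3 : Real.log N ≤ 4 * Real.log m := by
        have : Real.log N ≤ Real.log ((m : ℝ) ^ 4) :=
          Real.log_le_log (by positivity) (by exact_mod_cast h2.le)
        rwa [Real.log_pow] at this
      calc splitIndicator m = splitIndicator m * 1 := (mul_one _).symm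
        _ ≤ splitIndicator m * (4 * Real.log m / Real.log N) := by
          refine mul_le_mul_of_nonneg_left ?_ (splitIndicator_nonneg m)
          rwa [le_div_iff₀ hlog, one_mul]
        _ = _ := by ring
  refine (Finset.sum_le_sum h1).trans ?_
  rw [Finset.sum_add_distrib, Finset.mul_sum]
  refine add_le_add_left ?_ _
  rw [← Finset.sum_filter, Finset.sum_const, nsmul_eq_mul, mul_one]
  have : ((Finset.Ioc 0 k).filter fun m => m ∈ Finset.Ioc 0 t) ⊆ Finset.Ioc 0 t :=
    fun m hm => (Finset.mem_filter.1 hm).2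
  exact_mod_cast (Finset.card_le_card this).trans (by simp)

theorem sum_inv_sq_le_two (n : ℕ) : ∑ g ∈ Finset.Ioc 0 n, 1 / (g : ℝ) ^ 2 ≤ 2 := by
  have key : n ≠ 0 → ∑ g ∈ Finset.Ioc 0 n, 1 / (g : ℝ) ^ 2 ≤ 2 - 1 / (n : ℝ) := by
    intro hn
    induction n, Nat.one_le_iff_ne_zero.2 hn using Nat.le_induction with
    | base => norm_num [Finset.sum_Ioc_succ_top]
    | succ n hn1 ih =>
      rw [Finset.sum_Ioc_succ_top (Nat.zero_le n)]
      have hpos : (0 : ℝ) < n := by exact_mod_cast hn1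
      have h2 : 1 / ((n + 1 : ℕ) : ℝ) ^ 2 ≤ 1 / n - 1 / ((n + 1 : ℕ) : ℝ) := by
        push_cast
        rw [div_sub_div _ _ hpos.ne' (by positivity), div_le_div_iff₀ (by positivity) (by positivity)]
        nlinarith
      linarith [ih (by omega)]
  rcases eq_or_ne n 0 with rfl | hn
  · simp
  · have : 0 ≤ 1 / (n : ℝ) := by positivity
    linarith [key hn]

/-- Landau's upper bound for the number of integers represented by `x ^ 2 + 2 * y ^ 2`. -/
theorem representedCount_bound : ∃ C : ℝ, 0 < C ∧ ∀ N : ℕ, 3 ≤ N →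
    (representedCount N : ℝ) ≤ C * N / √(Real.log N) := by
  set c : ℝ := Real.log 4 + 4 with hc
  have hc0 : 0 < c := by
    have : 0 < Real.log 4 := Real.log_pos (by norm_num)
    linarith
  -- Twice the sum of 2N/s, from the small m, and 24cN/s, the main term with ∑ 1/g² ≤ 2.
  refine ⟨4 + 48 * c, by positivity, fun N hN => ?_⟩
  have hN0 : (0 : ℝ) < N := by positivity
  have hlog1 : 1 ≤ Real.log N := by
    rw [Real.le_log_iff_exp_le hN0]
    have : (3 : ℝ) ≤ N := by exact_mod_cast hN
    linarith [Real.exp_one_lt_three]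
  have hlog : 0 < Real.log N := by linarith
  set s := √(Real.log N) with hs
  have hs0 : 0 < s := Real.sqrt_pos.2 hlog
  have hss : s ^ 2 = Real.log N := Real.sq_sqrt hlog.le
  have hL : splitHarmonic N ≤ 3 * s := by
    refine abs_le_of_sq_le_sq' ?_ (by positivity) |>.2
    have := splitHarmonic_sq_le N
    nlinarith
  have h1 : ∀ g ∈ Finset.Ioc 0 N.sqrt, ∑ m ∈ Finset.Ioc 0 (N / g ^ 2), splitIndicator m
      ≤ N.sqrt.sqrt + 12 * c * N / s * (1 / (g : ℝ) ^ 2) := by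
    intro g hg
    have hg0 : 0 < g := (Finset.mem_Ioc.1 hg).1
    refine (sum_splitIndicator_le (by omega : 2 ≤ N) (N / g ^ 2)).trans (add_le_add_right ?_ _)
    have h2 := sum_splitIndicator_mul_log_le (N / g ^ 2)
    have h3 : ((N / g ^ 2 : ℕ) : ℝ) ≤ N / (g : ℝ) ^ 2 := by
      have := Nat.cast_div_le (α := ℝ) (m := N) (n := g ^ 2)
      push_cast at this
      exact this
    have h4 : splitHarmonic (N / g ^ 2) ≤ 3 * s :=
      (splitHarmonic_mono (Nat.div_le_self _ _)).trans hL
    have h5 : ∑ m ∈ Finset.Ioc 0 (N / g ^ 2), splitIndicator m * Real.log m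
        ≤ c * (N / (g : ℝ) ^ 2) * (3 * s) := by
      refine h2.trans ?_
      have := splitHarmonic_nonneg (N / g ^ 2)
      gcongr
    calc 4 / Real.log N * ∑ m ∈ Finset.Ioc 0 (N / g ^ 2), splitIndicator m * Real.log m
        ≤ 4 / Real.log N * (c * (N / (g : ℝ) ^ 2) * (3 * s)) := by gcongr
      _ = 12 * c * N / s * (1 / (g : ℝ) ^ 2) := by
        rw [← hss]
        field_simp
        ring
  have h2 : ∑ g ∈ Finset.Ioc 0 N.sqrt, ∑ m ∈ Finset.Ioc 0 (N / g ^ 2), splitIndicator m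
      ≤ N.sqrt * N.sqrt.sqrt + 12 * c * N / s * 2 := by
    refine (Finset.sum_le_sum h1).trans ?_
    rw [Finset.sum_add_distrib, ← Finset.mul_sum, Finset.sum_const, nsmul_eq_mul, Nat.card_Ioc,
      Nat.sub_zero]
    gcongr
    exact sum_inv_sq_le_two _
  -- The trivial part is at most N^(3/4), and log N ≤ 2√N gives s ≤ 2 N^(1/4).
  have h3 : (N.sqrt : ℝ) * N.sqrt.sqrt ≤ 2 * N / s := by
    have e1 : (N.sqrt : ℝ) ≤ √N := Real.nat_sqrt_le_real_sqrt
    have e2 : (N.sqrt.sqrt : ℝ) ≤ √(√N) :=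
      Real.nat_sqrt_le_real_sqrt.trans (Real.sqrt_le_sqrt e1)
    have e3 : s ≤ 2 * √(√N) := by
      have a1 : Real.log N ≤ 2 * √N := by
        have : Real.log √N ≤ √N := (Real.log_le_sub_one_of_pos (Real.sqrt_pos.2 hN0)).trans (by linarith)
        rw [Real.log_sqrt hN0.le] at this
        linarith
      rw [hs, Real.sqrt_le_left (by positivity), mul_pow, Real.sq_sqrt (Real.sqrt_nonneg _)]
      linarith [Real.sqrt_nonneg (N : ℝ)]
    rw [le_div_iff₀ hs0]
    calc (N.sqrt : ℝ) * N.sqrt.sqrt * s ≤ √N * √(√N) * (2 * √(√N)) := by gcongr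
      _ = 2 * √N * (√(√N) * √(√N)) := by ring
      _ = 2 * N := by
        rw [Real.mul_self_sqrt (Real.sqrt_nonneg _), mul_assoc, Real.mul_self_sqrt hN0.le]
  calc (representedCount N : ℝ) ≤ _ := representedCount_le_sum N
    _ ≤ 2 * (2 * N / s + 12 * c * N / s * 2) := by gcongr; linarith
    _ = (4 + 48 * c) * N / s := by ring

end RepresentedNumbers

/-! ### Abel summation for power series -/

section AbelSummation

theorem summable_mul_pow_of_abs_le {a : ℕ → ℝ} (ha : ∀ n, |a n| ≤ n) {z : ℝ} (hz : |z| < 1) :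
    Summable fun n => a n * z ^ n := by
  have h := summable_pow_mul_geometric_of_norm_lt_one 1 (R := ℝ) (r := |z|) (by simpa using hz)
  refine Summable.of_norm_bounded h fun n => ?_
  rw [norm_mul, norm_pow, Real.norm_eq_abs, Real.norm_eq_abs, pow_one]
  gcongr
  exact ha n

/-- If the partial sums of `a` are at most `u + v * n`, then `∑ a n * z ^ n` is at most
`u + v / (1 - z)`. -/
theorem tsum_mul_pow_le {a : ℕ → ℝ} (ha : ∀ n, 0 ≤ a n) (ha' : ∀ n, a n ≤ n) {u v : ℝ}
    (hv : 0 ≤ v) (h : ∀ n : ℕ, ∑ k ∈ Finset.range (n + 1), a k ≤ u + v * n) {z : ℝ} (hz0 : 0 ≤ z)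
    (hz1 : z < 1) : ∑' n, a n * z ^ n ≤ u + v / (1 - z) := by
  have hz : |z| < 1 := by rwa [abs_of_nonneg hz0]
  have hs := summable_mul_pow_of_abs_le (fun n => by rw [abs_of_nonneg (ha n)]; exact ha' n) hz
  have hg := summable_geometric_of_lt_one hz0 hz1
  -- The Cauchy product with the geometric series replaces coefficients by partial sums.
  have h1 := tsum_mul_tsum_eq_tsum_sum_range_of_summable_norm hs.norm hg.norm
  have hcs := summable_norm_sum_mul_range_of_summable_norm hs.norm hg.norm
  have e : ∀ n : ℕ, ∑ k ∈ Finset.range (n + 1), a k * z ^ k * z ^ (n - k)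
      = (∑ k ∈ Finset.range (n + 1), a k) * z ^ n := by
    intro n
    rw [Finset.sum_mul]
    refine Finset.sum_congr rfl fun k hk => ?_
    rw [mul_assoc, ← pow_add, Nat.add_sub_cancel' (Nat.lt_succ_iff.1 (Finset.mem_range.1 hk))]
  simp only [e] at h1 hcs
  have hn : HasSum (fun n : ℕ => (n : ℝ) * z ^ n) (z / (1 - z) ^ 2) :=
    hasSum_coe_mul_geometric_of_norm_lt_one (by simpa using hz)
  have hb : HasSum (fun n : ℕ => u * z ^ n + v * (n * z ^ n))
      (u * (1 - z)⁻¹ + v * (z / (1 - z) ^ 2)) :=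
    ((hasSum_geometric_of_lt_one hz0 hz1).mul_left u).add (hn.mul_left v)
  have h2 : ∑' n : ℕ, (∑ k ∈ Finset.range (n + 1), a k) * z ^ n
      ≤ u * (1 - z)⁻¹ + v * (z / (1 - z) ^ 2) := by
    rw [← hb.tsum_eq]
    refine Summable.tsum_le_tsum (fun n => ?_) hcs.of_norm hb.summable
    calc (∑ k ∈ Finset.range (n + 1), a k) * z ^ n ≤ (u + v * n) * z ^ n := by
          gcongr
          exact h n
      _ = _ := by ring
  rw [← h1, tsum_geometric_of_lt_one hz0 hz1] at h2
  have hpos : 0 < 1 - z := by linarith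
  have h3 : ∑' n, a n * z ^ n ≤ u + v * (z / (1 - z)) := by
    have := mul_le_mul_of_nonneg_right h2 hpos.le
    calc ∑' n, a n * z ^ n = (∑' n, a n * z ^ n) * (1 - z)⁻¹ * (1 - z) := by
          field_simp
      _ ≤ _ := this
      _ = _ := by field_simp
  refine h3.trans ?_
  rw [div_eq_mul_inv v]
  gcongr
  rw [div_eq_mul_inv]
  exact mul_le_of_le_one_left (by positivity) hz1.le

end AbelSummation

/-! ### The two estimates -/

section Main

/-- The box depends only on N, so for distinct n ≤ N the fibres are disjoint subsets of one set of
size at most N. -/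
theorem abs_p₂_le_card {n N : ℕ} (hn : n ≤ N) : |p₂ n| ≤
    (((Finset.Icc 1 N.sqrt ×ˢ Finset.Icc 1 N.sqrt).filter
      fun x => x.1 ^ 2 + 2 * (x.2 / 2) ^ 2 = n).card : ℤ) := by
  rw [p₂_eq_sum, Finset.sum_sigma']
  refine (Finset.abs_sum_le_sum_abs _ _).trans ?_
  have h1 : ∀ x ∈ (Finset.Icc 1 n).sigma fun r => Finset.Icc 1 r,
      |if n = x.1 ^ 2 + 2 * (x.2 / 2) ^ 2 then (-1 : ℤ) ^ (x.2 / 2) else 0|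
        = if n = x.1 ^ 2 + 2 * (x.2 / 2) ^ 2 then 1 else 0 := by
    intro x _
    split_ifs <;> simp
  rw [Finset.sum_congr rfl h1, ← Finset.sum_filter, Finset.sum_const, nsmul_eq_mul, mul_one]
  refine Nat.cast_le.2 (Finset.card_le_card_of_injOn (fun x => (x.1, x.2)) ?_ ?_)
  · rintro ⟨r, k⟩ hx
    simp only [Finset.coe_filter, Finset.mem_sigma, Finset.mem_Icc, Set.mem_ofPred_eq,
      Finset.mem_product] at hx ⊢
    obtain ⟨⟨⟨h1, _⟩, h2, h3⟩, h4⟩ := hx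
    have : r ≤ N.sqrt := by
      rw [Nat.le_sqrt]
      nlinarith [Nat.zero_le (2 * (k / 2) ^ 2)]
    exact ⟨⟨⟨h1, this⟩, h2, h3.trans this⟩, h4.symm⟩
  · rintro ⟨r, k⟩ _ ⟨r', k'⟩ _ h
    simp only [Prod.mk.injEq] at h
    obtain ⟨rfl, rfl⟩ := h
    rfl

theorem sum_abs_p₂_le (N : ℕ) : ∑ n ∈ Finset.range (N + 1), |p₂ n| ≤ N := by
  refine (Finset.sum_le_sum fun n hn =>
    abs_p₂_le_card (Nat.lt_succ_iff.1 (Finset.mem_range.1 hn))).trans ?_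
  rw [← Nat.cast_sum]
  refine Nat.cast_le.2 ?_
  rw [← Finset.card_biUnion fun a _ b _ hab => Finset.disjoint_filter.2 fun x _ ha hb =>
    hab (ha.symm.trans hb)]
  refine (Finset.card_le_card (Finset.biUnion_subset.2 fun n _ =>
    Finset.filter_subset _ _)).trans ?_
  rw [Finset.card_product, Nat.card_Icc, Nat.add_sub_cancel]
  exact Nat.sqrt_le N

theorem abs_p₂_le (n : ℕ) : |p₂ n| ≤ n :=
  (Finset.single_le_sum (f := fun k => |p₂ k|) (fun _ _ => abs_nonneg _)
    (Finset.self_mem_range_succ n)).trans (sum_abs_p₂_le n)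

theorem exists_eq_sq_add_two_mul_sq_of_p₂_ne_zero {n : ℕ} (h : p₂ n ≠ 0) :
    ∃ x y : ℕ, n = x ^ 2 + 2 * y ^ 2 := by
  by_contra hn
  push Not at hn
  refine h ?_
  rw [p₂_eq_sum]
  exact Finset.sum_eq_zero fun r _ => Finset.sum_eq_zero fun k _ => if_neg (hn r (k / 2))

theorem sum_indicator_p₂_pos_le (N : ℕ) :
    ∑ n ∈ Finset.range (N + 1), {n : ℕ | 1 ≤ n ∧ 0 < p₂ n}.indicator (fun _ => (1 : ℝ)) n
      ≤ representedCount N := by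
  classical
  simp only [Set.indicator_apply]
  rw [← Finset.sum_filter, Finset.sum_const, nsmul_eq_mul, mul_one, representedCount]
  refine Nat.cast_le.2 (Finset.card_le_card fun n hn => ?_)
  simp only [Finset.mem_filter, Finset.mem_range, Set.mem_ofPred_eq, Finset.mem_Ioc] at hn ⊢
  exact ⟨⟨hn.2.1, by omega⟩, exists_eq_sq_add_two_mul_sq_of_p₂_ne_zero hn.2.2.ne'⟩

theorem summable_p₂_mul_pow {z : ℝ} (hz : |z| < 1) : Summable fun n : ℕ => (p₂ n : ℝ) * z ^ n :=
  summable_mul_pow_of_abs_le (fun n => by exact_mod_cast abs_p₂_le n) hz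

theorem tsum_p₂_isBigO : (fun z : ℝ => ∑' n : {n : ℕ // 1 ≤ n}, (p₂ n : ℝ) * z ^ (n : ℕ))
    =O[𝓝[<] 1] fun z : ℝ => 1 / (1 - z) := by
  refine IsBigO.of_bound 1 ?_
  filter_upwards [Ioo_mem_nhdsLT (zero_lt_one' ℝ)] with z hz
  obtain ⟨hz0, hz1⟩ := hz
  have hz : |z| < 1 := by rwa [abs_of_pos hz0]
  have hs := (summable_p₂_mul_pow hz).norm
  have hnorm : (fun n : ℕ => ‖(p₂ n : ℝ) * z ^ n‖) = fun n : ℕ => |(p₂ n : ℝ)| * z ^ n := by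
    funext n
    rw [norm_mul, norm_pow, Real.norm_eq_abs, Real.norm_eq_abs, abs_of_pos hz0]
  have h1 : ‖∑' n : {n : ℕ // 1 ≤ n}, (p₂ n : ℝ) * z ^ (n : ℕ)‖
      ≤ ∑' n : {n : ℕ // 1 ≤ n}, ‖(p₂ n : ℝ) * z ^ (n : ℕ)‖ :=
    norm_tsum_le_tsum_norm (hs.comp_injective Subtype.val_injective)
  have h2 : ∑' n : {n : ℕ // 1 ≤ n}, ‖(p₂ n : ℝ) * z ^ (n : ℕ)‖
      ≤ ∑' n : ℕ, ‖(p₂ n : ℝ) * z ^ n‖ :=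
    Summable.tsum_subtype_le (fun n : ℕ => ‖(p₂ n : ℝ) * z ^ n‖) {n : ℕ | 1 ≤ n}
      (fun n => norm_nonneg _) hs
  have h3 : ∑' n : ℕ, ‖(p₂ n : ℝ) * z ^ n‖ ≤ 0 + 1 / (1 - z) := by
    rw [hnorm]
    refine tsum_mul_pow_le (fun n => abs_nonneg _) (fun n => by exact_mod_cast abs_p₂_le n)
      zero_le_one (fun n => ?_) hz0.le hz1
    rw [zero_add, one_mul]
    exact_mod_cast sum_abs_p₂_le n
  rw [one_mul, Real.norm_of_nonneg (one_div_nonneg.2 (by linarith : 0 ≤ 1 - z))]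
  linarith

theorem summable_p₂_pos_pow {z : ℝ} (hz : |z| < 1) :
    Summable fun n : {n : ℕ // 1 ≤ n ∧ 0 < p₂ n} => z ^ (n : ℕ) := by
  have h : Summable fun n : ℕ => z ^ n := summable_geometric_of_abs_lt_one hz
  exact h.comp_injective Subtype.val_injective

theorem tsum_p₂_pos_isBigO : (fun z : ℝ => ∑' n : {n : ℕ // 1 ≤ n ∧ 0 < p₂ n}, z ^ (n : ℕ))
    =O[𝓝[<] 1] fun z : ℝ => 1 / ((1 - z) * √(Real.log (1 / (1 - z)))) := by
  obtain ⟨C, hC, hbound⟩ := representedCount_bound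
  refine IsBigO.of_bound (1 + 2 * C) ?_
  -- z > 8/9 gives N = 1/(1 - z) > 9, so U = √N ≥ 3 and Landau's bound applies to every n ≥ U.
  filter_upwards [Ioo_mem_nhdsLT (show (8 / 9 : ℝ) < 1 by norm_num)] with z hz
  obtain ⟨hz9, hz1⟩ := hz
  have hz0 : 0 ≤ z := by linarith
  have hpos : 0 < 1 - z := by linarith
  set N : ℝ := 1 / (1 - z) with hN
  have hN9 : 9 ≤ N := by
    rw [hN, le_div_iff₀ hpos]
    linarith
  have hN0 : 0 < N := by linarith
  set U : ℝ := √N with hU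
  have hU3 : 3 ≤ U := Real.le_sqrt_of_sq_le (by linarith)
  have hUU : U * U = N := Real.mul_self_sqrt hN0.le
  have hlogU : Real.log U = Real.log N / 2 := Real.log_sqrt hN0.le
  have hlogN : 0 < Real.log N := Real.log_pos (by linarith)
  have hlogU0 : 0 < Real.log U := Real.log_pos (by linarith)
  set S : Set ℕ := {n : ℕ | 1 ≤ n ∧ 0 < p₂ n} with hS
  have e : ∑' n : {n : ℕ // 1 ≤ n ∧ 0 < p₂ n}, z ^ (n : ℕ)
      = ∑' n : ℕ, S.indicator (fun _ => (1 : ℝ)) n * z ^ n := by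
    refine (tsum_subtype S fun n : ℕ => z ^ n).trans (tsum_congr fun n => ?_)
    by_cases hn : n ∈ S <;> simp [hn]
  -- Partial sums are at most n for n ≤ U and at most C n / √log U beyond; since log U = (log N)/2,
  -- cutting at √N loses only a constant.
  have h1 : ∑' n : ℕ, S.indicator (fun _ => (1 : ℝ)) n * z ^ n
      ≤ U + C / √(Real.log U) / (1 - z) := by
    refine tsum_mul_pow_le (fun n => Set.indicator_nonneg (fun _ _ => zero_le_one) n) (fun n => ?_)
      (by positivity) (fun n => ?_) hz0 hz1
    · by_cases hn : n ∈ S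
      · rw [Set.indicator_of_mem hn]
        exact_mod_cast hn.1
      · rw [Set.indicator_of_notMem hn]
        exact Nat.cast_nonneg n
    · refine (sum_indicator_p₂_pos_le n).trans ?_
      have hv : 0 ≤ C / √(Real.log U) * n := by positivity
      rcases le_total (n : ℝ) U with hn | hn
      · have : (representedCount n : ℝ) ≤ n := by exact_mod_cast representedCount_le n
        linarith
      · have hn3 : 3 ≤ n := by exact_mod_cast hU3.trans hn
        have h2 : C * n / √(Real.log n) ≤ C / √(Real.log U) * n := by
          rw [div_mul_eq_mul_div]
          refine div_le_div_of_nonneg_left (by positivity) (Real.sqrt_pos.2 hlogU0) ?_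
          exact Real.sqrt_le_sqrt (Real.log_le_log (by linarith) hn)
        linarith [hbound n hn3]
  have h2 : U ≤ N / √(Real.log N) := by
    rw [le_div_iff₀ (Real.sqrt_pos.2 hlogN), ← hUU]
    refine mul_le_mul_of_nonneg_left (Real.sqrt_le_sqrt ?_) (by linarith)
    rw [hUU]
    exact (Real.log_le_sub_one_of_pos hN0).trans (by linarith)
  have h3 : C / √(Real.log U) ≤ 2 * C / √(Real.log N) := by
    rw [div_le_div_iff₀ (Real.sqrt_pos.2 hlogU0) (Real.sqrt_pos.2 hlogN), mul_comm 2 C, mul_assoc]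
    refine mul_le_mul_of_nonneg_left ?_ hC.le
    rw [Real.sqrt_le_left (by positivity), mul_pow, Real.sq_sqrt hlogU0.le, hlogU]
    linarith
  have hrhs : 1 / ((1 - z) * √(Real.log N)) = N / √(Real.log N) := by
    rw [hN, div_div]
  have hlhs : 0 ≤ ∑' n : {n : ℕ // 1 ≤ n ∧ 0 < p₂ n}, z ^ (n : ℕ) :=
    tsum_nonneg fun n => pow_nonneg hz0 _
  rw [hrhs, Real.norm_of_nonneg hlhs, Real.norm_of_nonneg (by positivity), e]
  calc ∑' n : ℕ, S.indicator (fun _ => (1 : ℝ)) n * z ^ n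
      ≤ U + C / √(Real.log U) / (1 - z) := h1
    _ ≤ N / √(Real.log N) + 2 * C / √(Real.log N) / (1 - z) := by gcongr
    _ = (1 + 2 * C) * (N / √(Real.log N)) := by
      rw [hN]
      ring

end Main

theorem mainTheorem2 :
    (∀ z : ℝ, |z| < 1 → Summable fun n : {n : ℕ // 1 ≤ n} => (p₂ n : ℝ) * z ^ (n : ℕ)) ∧
    (∀ z : ℝ, |z| < 1 → Summable fun n : {n : ℕ // 1 ≤ n ∧ 0 < p₂ n} => z ^ (n : ℕ)) ∧
    ((fun z : ℝ => ∑' n : {n : ℕ // 1 ≤ n}, (p₂ n : ℝ) * z ^ (n : ℕ))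
      =O[𝓝[<] 1] fun z : ℝ => 1 / (1 - z)) ∧
    ((fun z : ℝ => ∑' n : {n : ℕ // 1 ≤ n ∧ 0 < p₂ n}, z ^ (n : ℕ))
      =O[𝓝[<] 1] fun z : ℝ => 1 / ((1 - z) * √(Real.log (1 / (1 - z))))) :=
  ⟨fun _ hz => (summable_p₂_mul_pow hz).comp_injective Subtype.val_injective,
    fun _ hz => summable_p₂_pos_pow hz, tsum_p₂_isBigO, tsum_p₂_pos_isBigO⟩
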